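/- All vector spaces are real. Let $(\gamma_n)_{n\ge1}$ denote independent standard Gaussian random variables. For Banach spaces $X,Y$, a family $\mathscr T\subseteq\mathscr L(X,Y)$ is \emph{$\gamma$-bounded} if there is a constant $C\ge 0$ such that $$\mathbb E\Big\|\sum_{n=1}^N\gamma_nT_nx_n\Big\|^2\le C^2\,\mathbb E\Big\|\sum_{n=1}^N\gamma_nx_n\Big\|^2$$ for all $N$, all $T_1,\dots,T_N\in\mathscr T$ and all $x_1,\dots,x_N\in X$; the least such $C$ is its \emph{$\gamma$-bound}. For a Hilbert space $H$, $\gamma(H,X)$ is the completion of the space $H\otimes X$ of finite rank operators in the norm $\big\|\sum_{n=1}^N h_n\otimes x_n\big\|_{\gamma(H,X)}=\big(\mathbb E\|\sum_{n=1}^N\gamma_nx_n\|^2\big)^{1/2}$, $(h_n)_{n=1}^N$ orthonormal, viewed as a space of bounded operators from $H$ to $X$; here $h\otimes x$ is the operator $g\mapsto\langle g,h\rangle x$. For $I=(0,T)$ or $I=\Delta$ put $\gamma(I;X)=\gamma(L^2(I),X)$. A strongly measurable function $f:I\to X$ \emph{defines an element of} $\gamma(I;X)$ if $\langle f,x^*\rangle\in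 L^2(I)$ for all $x^*\in X^*$ and the Pettis integral operator $g\mapsto\int_I fg$ belongs to $\gamma(I;X)$. Strong measurability is understood up to Lebesgue-null sets, and elements of $L^2(I)\otimes X$ are identified with the (classes of) functions $\sum_{n=1}^N h_n(\cdot)x_n$. Let $0<T<\infty$ and $\Delta=\{(s,t)\in(0,T)\times(0,T):\ s\le t\}$. Let $X$ and $Y$ be Banach spaces and assume that $Y$ has no closed subspace isomorphic to $c_0$. (1) Let $M:(0,T)\to\mathscr L(X,Y)$ be such that $t\mapsto M(t)x$ is strongly measurable for all $x\in X$ and $M$ has $\gamma$-bounded range, with $\gamma$-bound $\gamma(M)$. Then for every $f\in L^2(0,T)\otimes X$ the function $$\Phi f:\ t\mapsto\int_0^tM(t-s)f(s)\,ds$$ is well defined for all $t\in(0,T)$ as a Bochner integral, and it defines an element of $\gamma(0,T;Y)$ with $$\|\Phi f\|_{\gamma(0,T;Y)}\le T\,\gamma(M)\,\|f\|_{\gamma(0,T;X)}.$$ (2) Let $M:\Delta\to\mathscr L(X,Y)$ be such that $(s,t)\mapsto M(s,t)x$ is strongly measurable for all $x\in X$ and $M$ has $\gamma$-bounded range, with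 $\gamma$-bound $\gamma(M)$. Then for every $f\in L^2(\Delta)\otimes X$ the function $$\Phi f:\ t\mapsto\int_0^tM(s,t)f(s,t)\,ds$$ is well defined for almost all $t\in(0,T)$ as a Bochner integral, and it defines an element of $\gamma(0,T;Y)$ with $$\|\Phi f\|_{\gamma(0,T;Y)}\le T^{1/2}\,\gamma(M)\,\|f\|_{\gamma(\Delta;X)}.$$ As a consequence, the mappings $f\mapsto\Phi f$ extend uniquely to bounded linear operators from $\gamma(0,T;X)$ to $\gamma(0,T;Y)$ and from $\gamma(\Delta;X)$ to $\gamma(0,T;Y)$, of norms at most $T\gamma(M)$ and $T^{1/2}\gamma(M)$, respectively. -/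

import Mathlib

open MeasureTheory ProbabilityTheory Set
open scoped NNReal ENNReal InnerProductSpace

noncomputable section

namespace GammaRad

/-! ### Gaussian sums and `γ`-boundedness -/

section GaussianSums

variable {X : Type*} [NormedAddCommGroup X] [NormedSpace ℝ X]

/-- `(E ‖∑ₙ γₙ xₙ‖²)^{1/2}`, where `γ₁, …, γ_N` are independent standard Gaussian variables. -/
def gaussianNorm {N : ℕ} (x : Fin N → X) : ℝ≥0∞ :=
  eLpNorm (fun g : Fin N → ℝ ↦ ∑ n, g n • x n) 2 (Measure.pi fun _ ↦ gaussianReal 0 1)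

lemma gaussianNorm_eq_lintegral {N : ℕ} (x : Fin N → X) :
    gaussianNorm x = (∫⁻ g : Fin N → ℝ, ‖∑ n, g n • x n‖ₑ ^ 2
      ∂(Measure.pi fun _ ↦ gaussianReal 0 1)) ^ (1 / 2 : ℝ) := by
  rw [gaussianNorm, eLpNorm_eq_lintegral_rpow_enorm_toReal (by simp) (by simp)]
  simp

lemma aestronglyMeasurable_gaussianSum {N : ℕ} (x : Fin N → X) :
    AEStronglyMeasurable (fun g : Fin N → ℝ ↦ ∑ n, g n • x n)
      (Measure.pi fun _ ↦ gaussianReal 0 1) :=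
  (by fun_prop : Continuous (fun g : Fin N → ℝ ↦ ∑ n, g n • x n)).aestronglyMeasurable

lemma gaussianNorm_add_le {N : ℕ} (x y : Fin N → X) :
    gaussianNorm (fun n ↦ x n + y n) ≤ gaussianNorm x + gaussianNorm y := by
  have h := eLpNorm_add_le (p := 2) (aestronglyMeasurable_gaussianSum x)
    (aestronglyMeasurable_gaussianSum y) (by norm_num)
  refine le_trans (le_of_eq ?_) h
  unfold gaussianNorm
  congr 1
  ext g
  simp [Finset.sum_add_distrib]

lemma gaussianNorm_smul {N : ℕ} (c : ℝ) (x : Fin N → X) :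
    gaussianNorm (fun n ↦ c • x n) = ‖c‖ₑ * gaussianNorm x := by
  unfold gaussianNorm
  rw [← eLpNorm_const_smul]
  congr 1
  ext g
  simp [Finset.smul_sum, smul_comm c]

lemma eLpNorm_eval_smul {N : ℕ} (n : Fin N) (y : X) :
    eLpNorm (fun g : Fin N → ℝ ↦ g n • y) 2 (Measure.pi fun _ ↦ gaussianReal 0 1) = ‖y‖ₑ := by
  have h1 : eLpNorm (fun g : Fin N → ℝ ↦ g n • y) 2 (Measure.pi fun _ ↦ gaussianReal 0 1)
      = eLpNorm (fun r : ℝ ↦ r • y) 2 (gaussianReal 0 1) := by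
    have hm := measurePreserving_eval (fun _ : Fin N ↦ gaussianReal 0 1) n
    exact eLpNorm_comp_measurePreserving (g := fun r : ℝ ↦ r • y)
      (by fun_prop : Continuous (fun r : ℝ ↦ r • y)).aestronglyMeasurable hm
  have h2 : ∫⁻ r : ℝ, ‖r‖ₑ ^ 2 ∂(gaussianReal 0 1) = 1 := by
    have hv : Var[id; gaussianReal 0 1] = 1 := by simp
    have hev := (memLp_id_gaussianReal (μ := 0) (v := 1) 2).ofReal_variance_eq
    rw [hv] at hev
    simpa [evariance] using hev.symm
  rw [h1, eLpNorm_eq_lintegral_rpow_enorm_toReal (by simp) (by simp)]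
  simp only [enorm_smul, ENNReal.toReal_ofNat, ENNReal.rpow_ofNat, mul_pow]
  rw [lintegral_mul_const _ (by fun_prop), h2, one_mul, one_div, ← ENNReal.rpow_natCast,
    ← ENNReal.rpow_mul]
  simp

lemma gaussianNorm_single (x : Fin 1 → X) : gaussianNorm x = ‖x 0‖ₑ := by
  rw [← eLpNorm_eval_smul (0 : Fin 1) (x 0)]
  simp [gaussianNorm]

lemma gaussianNorm_le_sum {N : ℕ} (x : Fin N → X) : gaussianNorm x ≤ ∑ n, ‖x n‖ₑ := by
  unfold gaussianNorm
  have := eLpNorm_sum_le (s := Finset.univ) (p := 2)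
    (μ := Measure.pi fun _ : Fin N ↦ gaussianReal 0 1)
    (f := fun (n : Fin N) (g : Fin N → ℝ) ↦ g n • x n)
    (fun n _ ↦ (by fun_prop : Continuous (fun g : Fin N → ℝ ↦ g n • x n)).aestronglyMeasurable)
    (by norm_num)
  simp only [eLpNorm_eval_smul] at this
  refine le_trans (le_of_eq ?_) this
  congr 1
  ext g
  simp

lemma gaussianNorm_ne_top {N : ℕ} (x : Fin N → X) : gaussianNorm x ≠ ∞ :=
  ne_top_of_le_ne_top (by simp) (gaussianNorm_le_sum x)

variable {Y : Type*} [NormedAddCommGroup Y] [NormedSpace ℝ Y]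

/-- `C` is an admissible constant for the `γ`-boundedness of the operator family `𝒯`. -/
def HasGammaBound (𝒯 : Set (X →L[ℝ] Y)) (C : ℝ≥0) : Prop :=
  ∀ (N : ℕ) (S : Fin N → X →L[ℝ] Y) (x : Fin N → X), (∀ n, S n ∈ 𝒯) →
    gaussianNorm (fun n ↦ S n (x n)) ≤ C * gaussianNorm x

/-- `γ`-boundedness of a family of bounded operators. -/
def IsGammaBounded (𝒯 : Set (X →L[ℝ] Y)) : Prop := ∃ C : ℝ≥0, HasGammaBound 𝒯 C

/-- The `γ`-bound: the least admissible constant. -/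
def gammaBound (𝒯 : Set (X →L[ℝ] Y)) : ℝ≥0 := sInf {C : ℝ≥0 | HasGammaBound 𝒯 C}

lemma hasGammaBound_gammaBound {𝒯 : Set (X →L[ℝ] Y)} (h : IsGammaBounded 𝒯) :
    HasGammaBound 𝒯 (gammaBound 𝒯) := by
  intro N S x hS
  have hx := gaussianNorm_ne_top x
  have hy := gaussianNorm_ne_top (fun n ↦ S n (x n))
  lift gaussianNorm x to ℝ≥0 using hx with a ha
  lift gaussianNorm (fun n ↦ S n (x n)) to ℝ≥0 using hy with b hb
  have key : ∀ C : ℝ≥0, HasGammaBound 𝒯 C → b ≤ C * a := by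
    intro C hC
    have := hC N S x hS
    rw [← ha, ← hb] at this
    exact_mod_cast this
  suffices b ≤ gammaBound 𝒯 * a by exact_mod_cast this
  rcases eq_or_ne a 0 with rfl | ha0
  · obtain ⟨C, hC⟩ := h
    simpa using key C hC
  · rw [← div_le_iff₀ (pos_iff_ne_zero.2 ha0)]
    exact le_csInf h fun C hC ↦ (div_le_iff₀ (pos_iff_ne_zero.2 ha0)).2 (key C hC)

end GaussianSums

/-! ### `γ`-radonifying operators -/

section Gamma

variable {H : Type*} [NormedAddCommGroup H] [InnerProductSpace ℝ H]
variable {X : Type*} [NormedAddCommGroup X] [NormedSpace ℝ X]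

/-- The finite rank operator `∑ₙ hₙ ⊗ xₙ`, that is `h ↦ ∑ₙ ⟪hₙ, h⟫ xₙ`. -/
def tensorOp {N : ℕ} (h : Fin N → H) (x : Fin N → X) : H →L[ℝ] X :=
  ∑ n, (innerSL ℝ (h n)).smulRight (x n)

@[simp] lemma tensorOp_apply {N : ℕ} (h : Fin N → H) (x : Fin N → X) (v : H) :
    tensorOp h x v = ∑ n, ⟪h n, v⟫_ℝ • x n := by
  simp [tensorOp]

/-- The `γ`-norm of an operator, the supremum of `(E ‖∑ₙ γₙ T eₙ‖²)^{1/2}` over all finite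
orthonormal systems. For finite rank operators see `gammaNorm_tensorOp`. -/
def gammaNorm (T : H →L[ℝ] X) : ℝ≥0∞ :=
  ⨆ (N : ℕ) (e : Fin N → H) (_ : Orthonormal ℝ e), gaussianNorm fun n ↦ T (e n)

lemma gaussianNorm_le_gammaNorm (T : H →L[ℝ] X) {N : ℕ} {e : Fin N → H}
    (he : Orthonormal ℝ e) : gaussianNorm (fun n ↦ T (e n)) ≤ gammaNorm T :=
  le_iSup_of_le N (le_iSup_of_le e (le_iSup_of_le he le_rfl))

lemma gammaNorm_le {T : H →L[ℝ] X} {C : ℝ≥0∞}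
    (h : ∀ (N : ℕ) (e : Fin N → H), Orthonormal ℝ e → gaussianNorm (fun n ↦ T (e n)) ≤ C) :
    gammaNorm T ≤ C :=
  iSup_le fun N ↦ iSup_le fun e ↦ iSup_le fun he ↦ h N e he

lemma gammaNorm_add_le (S T : H →L[ℝ] X) : gammaNorm (S + T) ≤ gammaNorm S + gammaNorm T :=
  gammaNorm_le fun _ _ he ↦ (gaussianNorm_add_le _ _).trans
    (add_le_add (gaussianNorm_le_gammaNorm S he) (gaussianNorm_le_gammaNorm T he))

lemma gammaNorm_smul_le (c : ℝ) (T : H →L[ℝ] X) : gammaNorm (c • T) ≤ ‖c‖ₑ * gammaNorm T :=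
  gammaNorm_le fun _ _ he ↦ (gaussianNorm_smul c _).le.trans
    (mul_le_mul_right (gaussianNorm_le_gammaNorm T he) _)

lemma gammaNorm_smul (c : ℝ) (T : H →L[ℝ] X) : gammaNorm (c • T) = ‖c‖ₑ * gammaNorm T := by
  refine le_antisymm (gammaNorm_smul_le c T) ?_
  rcases eq_or_ne c 0 with rfl | hc
  · simp
  · have h := gammaNorm_smul_le c⁻¹ (c • T)
    rw [smul_smul, inv_mul_cancel₀ hc, one_smul] at h
    calc ‖c‖ₑ * gammaNorm T ≤ ‖c‖ₑ * (‖c⁻¹‖ₑ * gammaNorm (c • T)) := mul_le_mul_right h _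
      _ = gammaNorm (c • T) := by
        rw [← mul_assoc, ← enorm_mul, mul_inv_cancel₀ hc]; simp

lemma enorm_le_gammaNorm (T : H →L[ℝ] X) : ‖T‖ₑ ≤ gammaNorm T := by
  by_cases htop : gammaNorm T = ∞
  · simp [htop]
  lift gammaNorm T to ℝ≥0 using htop with a ha
  rw [enorm_le_coe]
  refine T.opNNNorm_le_of_unit_nnnorm fun v hv ↦ ?_
  have he : Orthonormal ℝ (fun _ : Fin 1 ↦ v) :=
    ⟨fun _ ↦ by simpa using congrArg NNReal.toReal hv,
      fun i j hij ↦ absurd (Subsingleton.elim i j) hij⟩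
  have := gaussianNorm_le_gammaNorm T he
  rw [gaussianNorm_single, ← ha] at this
  exact_mod_cast this

/-- The image of a standard Gaussian measure under a linear map with isometric adjoint. -/
lemma map_stdGaussian_of_adjoint {V W : Type*}
    [NormedAddCommGroup V] [InnerProductSpace ℝ V] [FiniteDimensional ℝ V]
    [MeasurableSpace V] [BorelSpace V]
    [NormedAddCommGroup W] [InnerProductSpace ℝ W] [FiniteDimensional ℝ W]
    [MeasurableSpace W] [BorelSpace W] (A : V →L[ℝ] W) (B : W → V)
    (hB : ∀ v w, ⟪A v, w⟫_ℝ = ⟪v, B w⟫_ℝ) (hn : ∀ w, ‖B w‖ = ‖w‖) :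
    (stdGaussian V).map A = stdGaussian W := by
  have := Measure.isProbabilityMeasure_map (μ := stdGaussian V) A.continuous.measurable.aemeasurable
  apply Measure.ext_of_charFun
  ext t
  rw [charFun_stdGaussian, charFun_apply, integral_map (by fun_prop) (by fun_prop)]
  simp_rw [hB]
  rw [← charFun_apply, charFun_stdGaussian, hn]

lemma norm_sum_smul_orthonormal {V : Type*} [NormedAddCommGroup V] [InnerProductSpace ℝ V]
    {N : ℕ} {e : Fin N → V} (he : Orthonormal ℝ e) (w : EuclideanSpace ℝ (Fin N)) :
    ‖∑ n, w n • e n‖ = ‖w‖ := by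
  rw [← sq_eq_sq₀ (norm_nonneg _) (norm_nonneg _), ← real_inner_self_eq_norm_sq,
    he.inner_sum, EuclideanSpace.real_norm_sq_eq]
  simp [sq]

lemma gaussianNorm_eq_stdGaussian {V : Type*}
    [NormedAddCommGroup V] [InnerProductSpace ℝ V] [FiniteDimensional ℝ V]
    [MeasurableSpace V] [BorelSpace V] (T : V →L[ℝ] X) {N : ℕ} {e : Fin N → V}
    (he : Orthonormal ℝ e) :
    gaussianNorm (fun n ↦ T (e n)) =
      eLpNorm (fun v ↦ T (∑ n, ⟪e n, v⟫_ℝ • e n)) 2 (stdGaussian V) := by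
  let A : V →L[ℝ] EuclideanSpace ℝ (Fin N) :=
    (EuclideanSpace.equiv (Fin N) ℝ).symm.toContinuousLinearMap.comp
      (ContinuousLinearMap.pi fun n ↦ innerSL ℝ (e n))
  have hA : ∀ v n, A v n = ⟪e n, v⟫_ℝ := fun v n ↦ by simp [A]
  have hmap : (stdGaussian V).map A = stdGaussian (EuclideanSpace ℝ (Fin N)) := by
    refine map_stdGaussian_of_adjoint A (fun w ↦ ∑ n, w n • e n) (fun v w ↦ ?_)
      (norm_sum_smul_orthonormal he)
    simp [PiLp.inner_apply, hA, inner_sum, inner_smul_right, real_inner_comm]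
  have hF : Continuous fun w : EuclideanSpace ℝ (Fin N) ↦ T (∑ n, w n • e n) := by fun_prop
  have h1 : (fun v ↦ T (∑ n, ⟪e n, v⟫_ℝ • e n)) =
      (fun w : EuclideanSpace ℝ (Fin N) ↦ T (∑ n, w n • e n)) ∘ A := by
    ext v; simp [hA]
  rw [h1, ← eLpNorm_map_measure hF.aestronglyMeasurable (by fun_prop), hmap,
    ← map_pi_eq_stdGaussian, eLpNorm_map_measure hF.aestronglyMeasurable (by fun_prop)]
  unfold gaussianNorm
  congr 1
  ext g
  simp

lemma eLpNorm_projection_le {V : Type*}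
    [NormedAddCommGroup V] [InnerProductSpace ℝ V] [FiniteDimensional ℝ V]
    [MeasurableSpace V] [BorelSpace V] (T : V →L[ℝ] X) {N : ℕ} {e : Fin N → V}
    (he : Orthonormal ℝ e) :
    eLpNorm (fun v ↦ T (∑ n, ⟪e n, v⟫_ℝ • e n)) 2 (stdGaussian V) ≤
      eLpNorm T 2 (stdGaussian V) := by
  let P : V →L[ℝ] V := tensorOp e e
  have hP : ∀ v, P v = ∑ n, ⟪e n, v⟫_ℝ • e n := fun v ↦ tensorOp_apply e e v
  let R : V →L[ℝ] V := (2 : ℝ) • P - ContinuousLinearMap.id ℝ V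
  have hR : ∀ v, R v = (2 : ℝ) • P v - v := fun v ↦ by simp [R]
  have hPs : ∀ v w, ⟪P v, w⟫_ℝ = ⟪v, P w⟫_ℝ := fun v w ↦ by
    simp [hP, inner_sum, sum_inner, inner_smul_right, inner_smul_left, real_inner_comm, mul_comm]
  have hPP : ∀ v, ⟪P v, P v⟫_ℝ = ⟪P v, v⟫_ℝ := fun v ↦ by
    rw [hP, he.inner_sum, sum_inner]
    simp [inner_smul_left]
  have hRn : ∀ v, ‖R v‖ = ‖v‖ := fun v ↦ by
    rw [← sq_eq_sq₀ (norm_nonneg _) (norm_nonneg _), hR, norm_sub_sq_real, norm_smul,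
      inner_smul_left, mul_pow, ← real_inner_self_eq_norm_sq (P v), hPP]
    simp
    ring
  have hmap : (stdGaussian V).map R = stdGaussian V :=
    map_stdGaussian_of_adjoint R R
      (fun v w ↦ by simp [hR, inner_sub_left, inner_sub_right, inner_smul_left,
        inner_smul_right, hPs]) hRn
  have hT : AEStronglyMeasurable T (stdGaussian V) := T.continuous.aestronglyMeasurable
  have hTR : AEStronglyMeasurable (T ∘ R) (stdGaussian V) :=
    (T.continuous.comp R.continuous).aestronglyMeasurable
  have hTRn : eLpNorm (T ∘ R) 2 (stdGaussian V) = eLpNorm T 2 (stdGaussian V) := by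
    rw [← eLpNorm_map_measure (by rw [hmap]; exact hT) (by fun_prop), hmap]
  have h1 : (fun v ↦ T (∑ n, ⟪e n, v⟫_ℝ • e n)) = (2⁻¹ : ℝ) • (⇑T + T ∘ R) := by
    ext v
    simp only [← hP, Pi.smul_apply, Pi.add_apply, Function.comp_apply, hR, map_sub, map_smul,
      add_sub_cancel, smul_smul]
    norm_num
  rw [h1, eLpNorm_const_smul]
  calc ‖(2⁻¹ : ℝ)‖ₑ * eLpNorm (⇑T + T ∘ R) 2 (stdGaussian V)
      ≤ ‖(2⁻¹ : ℝ)‖ₑ * (eLpNorm T 2 (stdGaussian V) + eLpNorm (T ∘ R) 2 (stdGaussian V)) :=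
        mul_le_mul_right (eLpNorm_add_le hT hTR (by norm_num)) _
    _ = (‖(2⁻¹ : ℝ)‖ₑ * ‖(2 : ℝ)‖ₑ) * eLpNorm T 2 (stdGaussian V) := by
        rw [hTRn, ← two_mul, ← mul_assoc]
        congr 2
        rw [Real.enorm_eq_ofReal (by norm_num)]; simp
    _ = eLpNorm T 2 (stdGaussian V) := by
        rw [← enorm_mul]; norm_num

/-- On finite rank operators `∑ₙ hₙ ⊗ xₙ` with `(hₙ)` orthonormal,
the `γ`-norm equals `(E ‖∑ₙ γₙ xₙ‖²)^{1/2}`. -/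
theorem gammaNorm_tensorOp {N : ℕ} {h : Fin N → H} (hh : Orthonormal ℝ h) (x : Fin N → X) :
    gammaNorm (tensorOp h x) = gaussianNorm x := by
  have hx : (fun n ↦ tensorOp h x (h n)) = x := by
    ext n
    simp [orthonormal_iff_ite.1 hh]
  refine le_antisymm (gammaNorm_le fun K e he ↦ ?_) ?_
  · let V : Submodule ℝ H := Submodule.span ℝ (range h ∪ range e)
    have : FiniteDimensional ℝ V :=
      FiniteDimensional.span_of_finite ℝ ((finite_range h).union (finite_range e))
    let _ : MeasurableSpace V := borel V
    have : BorelSpace V := ⟨rfl⟩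
    let h' : Fin N → V := fun n ↦ ⟨h n, Submodule.subset_span (Or.inl ⟨n, rfl⟩)⟩
    let e' : Fin K → V := fun n ↦ ⟨e n, Submodule.subset_span (Or.inr ⟨n, rfl⟩)⟩
    have hh' : Orthonormal ℝ h' := by
      rw [orthonormal_iff_ite] at hh ⊢
      exact hh
    have he' : Orthonormal ℝ e' := by
      rw [orthonormal_iff_ite] at he ⊢
      exact he
    let T : V →L[ℝ] X := (tensorOp h x).comp V.subtypeL
    have h1 : gaussianNorm x = eLpNorm T 2 (stdGaussian V) := by
      have := gaussianNorm_eq_stdGaussian T hh'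
      rw [show (fun n ↦ T (h' n)) = x from hx] at this
      rw [this]
      congr 1
      ext v
      have h2 : ∀ n, T (h' n) = x n := fun n ↦ congrFun hx n
      simp only [map_sum, map_smul, h2]
      exact (tensorOp_apply h x (v : H)).symm
    rw [h1]
    exact (gaussianNorm_eq_stdGaussian T he').le.trans (eLpNorm_projection_le T he')
  · have := gaussianNorm_le_gammaNorm (tensorOp h x) hh
    rwa [hx] at this

lemma gammaNorm_tensorOp_ne_top {N : ℕ} (h : Fin N → H) (x : Fin N → X) :
    gammaNorm (tensorOp h x) ≠ ∞ := by
  have h1 : ∀ (u : H) (y : X), gammaNorm ((innerSL ℝ u).smulRight y) ≠ ∞ := by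
    intro u y
    rcases eq_or_ne u 0 with rfl | hu
    · have h0 : (innerSL ℝ (0 : H)).smulRight y = (0 : ℝ) • (0 : H →L[ℝ] X) := by ext; simp
      rw [h0, gammaNorm_smul]
      simp
    · have ho : Orthonormal ℝ (fun _ : Fin 1 ↦ ‖u‖⁻¹ • u) :=
        ⟨fun _ ↦ by simp [norm_smul, hu], fun i j hij ↦ absurd (Subsingleton.elim i j) hij⟩
      have h0 : (innerSL ℝ u).smulRight y =
          ‖u‖ • tensorOp (fun _ : Fin 1 ↦ ‖u‖⁻¹ • u) (fun _ ↦ y) := by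
        ext v
        simp [inner_smul_left, smul_smul, hu]
      rw [h0, gammaNorm_smul, gammaNorm_tensorOp ho]
      exact ENNReal.mul_ne_top enorm_ne_top (gaussianNorm_ne_top _)
  have h2 : ∀ s : Finset (Fin N), gammaNorm (∑ n ∈ s, (innerSL ℝ (h n)).smulRight (x n)) ≠ ∞ := by
    intro s
    induction s using Finset.induction_on with
    | empty =>
      have h0 : (0 : H →L[ℝ] X) = (0 : ℝ) • 0 := by simp
      rw [Finset.sum_empty, h0, gammaNorm_smul]
      simp
    | insert a s ha ih =>
      rw [Finset.sum_insert ha]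
      exact ne_top_of_le_ne_top (ENNReal.add_ne_top.2 ⟨h1 _ _, ih⟩) (gammaNorm_add_le _ _)
  exact h2 Finset.univ

@[simp] lemma gammaNorm_zero : gammaNorm (0 : H →L[ℝ] X) = 0 := by
  simpa using gammaNorm_smul 0 (0 : H →L[ℝ] X)

lemma gammaNorm_neg (T : H →L[ℝ] X) : gammaNorm (-T) = gammaNorm T := by
  simpa using gammaNorm_smul (-1) T

lemma tensorOp_append {N K : ℕ} (h : Fin N → H) (x : Fin N → X) (h' : Fin K → H) (x' : Fin K → X) :
    tensorOp (Fin.append h h') (Fin.append x x') = tensorOp h x + tensorOp h' x' := by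
  ext v
  simp [Fin.sum_univ_add]

lemma smul_tensorOp {N : ℕ} (c : ℝ) (h : Fin N → H) (x : Fin N → X) :
    c • tensorOp h x = tensorOp h (fun n ↦ c • x n) := by
  ext v
  simp [Finset.smul_sum, smul_comm c]

variable (H X) in
/-- The operators that are limits, in the `γ`-norm, of finite rank operators. -/
def gammaSubmodule : Submodule ℝ (H →L[ℝ] X) where
  carrier := {T | ∀ ε : ℝ≥0∞, 0 < ε →
    ∃ (N : ℕ) (h : Fin N → H) (x : Fin N → X), gammaNorm (T - tensorOp h x) < ε}
  zero_mem' := fun ε hε ↦ ⟨0, Fin.elim0, Fin.elim0, by simpa [tensorOp] using hε⟩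
  add_mem' := by
    intro S T hS hT ε hε
    obtain ⟨N, h, x, hx⟩ := hS (ε / 2) (ENNReal.half_pos hε.ne')
    obtain ⟨K, h', x', hx'⟩ := hT (ε / 2) (ENNReal.half_pos hε.ne')
    refine ⟨N + K, Fin.append h h', Fin.append x x', ?_⟩
    rw [tensorOp_append, add_sub_add_comm]
    exact (gammaNorm_add_le _ _).trans_lt
      ((ENNReal.add_lt_add hx hx').trans_eq (ENNReal.add_halves ε))
  smul_mem' := by
    intro c T hT ε hε
    obtain ⟨N, h, x, hx⟩ := hT (ε / (‖c‖ₑ + 1)) (ENNReal.div_pos hε.ne' (by simp))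
    refine ⟨N, h, fun n ↦ c • x n, ?_⟩
    rw [← smul_tensorOp, ← smul_sub, gammaNorm_smul]
    calc ‖c‖ₑ * gammaNorm (T - tensorOp h x) ≤ (‖c‖ₑ + 1) * gammaNorm (T - tensorOp h x) :=
          mul_le_mul_left (le_self_add) _
      _ < ε := by
          rw [mul_comm]
          exact (ENNReal.lt_div_iff_mul_lt (by simp) (by simp)).1 hx

variable (H X) in
/-- The Banach space `γ(H, X)` of `γ`-radonifying operators, normed by the `γ`-norm. -/
def Gamma : Type _ := gammaSubmodule H X

namespace Gamma

instance : AddCommGroup (Gamma H X) := inferInstanceAs (AddCommGroup (gammaSubmodule H X))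

instance : Module ℝ (Gamma H X) := inferInstanceAs (Module ℝ (gammaSubmodule H X))

variable (H X) in
/-- The bounded operator underlying an element of `γ(H, X)`. -/
def toOp : Gamma H X →ₗ[ℝ] (H →L[ℝ] X) := (gammaSubmodule H X).subtype

lemma toOp_injective : Function.Injective (toOp H X) := Subtype.val_injective

/-- The finite rank operator `∑ₙ hₙ ⊗ xₙ` as an element of `γ(H, X)`. -/
def tensor {N : ℕ} (h : Fin N → H) (x : Fin N → X) : Gamma H X :=
  ⟨tensorOp h x, fun ε hε ↦ ⟨N, h, x, by simpa using hε⟩⟩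

@[simp] lemma toOp_tensor {N : ℕ} (h : Fin N → H) (x : Fin N → X) :
    toOp H X (tensor h x) = tensorOp h x := rfl

lemma gammaNorm_toOp_ne_top (R : Gamma H X) : gammaNorm (toOp H X R) ≠ ∞ := by
  obtain ⟨N, h, x, hx⟩ := R.2 1 one_pos
  have := gammaNorm_add_le (R.1 - tensorOp h x) (tensorOp h x)
  rw [sub_add_cancel] at this
  exact ne_top_of_le_ne_top (ENNReal.add_ne_top.2 ⟨hx.ne_top, gammaNorm_tensorOp_ne_top h x⟩) this

instance : Norm (Gamma H X) := ⟨fun R ↦ (gammaNorm (toOp H X R)).toReal⟩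

lemma norm_def (R : Gamma H X) : ‖R‖ = (gammaNorm (toOp H X R)).toReal := rfl

lemma normedSpaceCore : NormedSpace.Core ℝ (Gamma H X) where
  norm_nonneg _ := ENNReal.toReal_nonneg
  norm_smul c R := by
    rw [norm_def, norm_def, map_smul, gammaNorm_smul, ENNReal.toReal_mul, toReal_enorm]
  norm_triangle R S := by
    rw [norm_def, norm_def, norm_def, map_add,
      ← ENNReal.toReal_add (gammaNorm_toOp_ne_top R) (gammaNorm_toOp_ne_top S)]
    exact ENNReal.toReal_mono
      (ENNReal.add_ne_top.2 ⟨gammaNorm_toOp_ne_top R, gammaNorm_toOp_ne_top S⟩)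
      (gammaNorm_add_le _ _)
  norm_eq_zero_iff R := by
    refine ⟨fun h ↦ ?_, fun h ↦ by simp [h, norm_def]⟩
    rw [norm_def, ENNReal.toReal_eq_zero_iff, or_iff_left (gammaNorm_toOp_ne_top R)] at h
    have := (enorm_le_gammaNorm (toOp H X R)).trans h.le
    have h0 : toOp H X R = 0 := by
      rw [← enorm_eq_zero (E := H →L[ℝ] X)]
      simpa only [nonpos_iff_eq_zero] using this
    exact toOp_injective (h0.trans (map_zero _).symm)

instance : NormedAddCommGroup (Gamma H X) := NormedAddCommGroup.ofCore normedSpaceCore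

instance : NormedSpace ℝ (Gamma H X) := NormedSpace.ofCore normedSpaceCore

lemma enorm_def (R : Gamma H X) : ‖R‖ₑ = gammaNorm (toOp H X R) := by
  rw [← ofReal_norm, norm_def, ENNReal.ofReal_toReal (gammaNorm_toOp_ne_top R)]

/-- For orthonormal `(hₙ)`, `‖∑ₙ hₙ ⊗ xₙ‖ = (E ‖∑ₙ γₙ xₙ‖²)^{1/2}`. -/
theorem norm_tensor {N : ℕ} {h : Fin N → H} (hh : Orthonormal ℝ h) (x : Fin N → X) :
    ‖tensor h x‖ = (gaussianNorm x).toReal := by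
  rw [norm_def, toOp_tensor, gammaNorm_tensorOp hh]

/-- The finite rank operators are dense in `γ(H, X)`. -/
theorem dense_tensor :
    Dense {R : Gamma H X | ∃ (N : ℕ) (h : Fin N → H) (x : Fin N → X), R = tensor h x} := by
  intro R
  rw [EMetric.mem_closure_iff]
  intro ε hε
  obtain ⟨N, h, x, hx⟩ := R.2 ε hε
  refine ⟨tensor h x, ⟨N, h, x, rfl⟩, ?_⟩
  rw [edist_eq_enorm_sub, enorm_def, map_sub]
  exact hx

/-- Together with `norm_tensor` and `dense_tensor`, completeness identifies `γ(H, X)` with the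
completion of the finite rank operators. -/
instance [CompleteSpace X] : CompleteSpace (Gamma H X) := by
  refine EMetric.complete_of_cauchySeq_tendsto fun u hu ↦ ?_
  rw [EMetric.cauchySeq_iff] at hu
  have hu' : CauchySeq fun n ↦ toOp H X (u n) := by
    rw [EMetric.cauchySeq_iff]
    intro ε hε
    obtain ⟨K, hK⟩ := hu ε hε
    refine ⟨K, fun m hm n hn ↦ lt_of_le_of_lt ?_ (hK m hm n hn)⟩
    rw [edist_eq_enorm_sub, edist_eq_enorm_sub, enorm_def, map_sub]
    exact enorm_le_gammaNorm _
  obtain ⟨T, hT⟩ := cauchySeq_tendsto_of_complete hu'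
  have key : ∀ (δ : ℝ≥0∞) (n : ℕ), (∀ᶠ m in Filter.atTop, edist (u m) (u n) ≤ δ) →
      gammaNorm (T - toOp H X (u n)) ≤ δ := by
    intro δ n hδ
    refine gammaNorm_le fun N e he ↦ ?_
    have hlim : Filter.Tendsto (fun m ↦ (∑ i, ‖T (e i) - toOp H X (u m) (e i)‖ₑ) + δ)
        Filter.atTop (nhds ((∑ i, ‖T (e i) - T (e i)‖ₑ) + δ)) := by
      refine Filter.Tendsto.add (tendsto_finsetSum _ fun i _ ↦ ?_) tendsto_const_nhds
      refine (continuous_enorm.tendsto _).comp (tendsto_const_nhds.sub ?_)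
      exact ((ContinuousLinearMap.apply ℝ X (e i)).continuous.tendsto T).comp hT
    simp only [sub_self, enorm_zero, Finset.sum_const_zero, zero_add] at hlim
    refine ge_of_tendsto hlim (hδ.mono fun m hm ↦ ?_)
    rw [edist_eq_enorm_sub, enorm_def, map_sub] at hm
    calc gaussianNorm (fun i ↦ (T - toOp H X (u n)) (e i))
        = gaussianNorm (fun i ↦ (T (e i) - toOp H X (u m) (e i)) +
            (toOp H X (u m) - toOp H X (u n)) (e i)) := by
          congr 1; ext i; simp
      _ ≤ _ := (gaussianNorm_add_le _ _).trans
          (add_le_add (gaussianNorm_le_sum _) ((gaussianNorm_le_gammaNorm _ he).trans hm))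
  have key' : ∀ ε : ℝ≥0∞, 0 < ε → ∃ K, ∀ n ≥ K, gammaNorm (T - toOp H X (u n)) ≤ ε := by
    intro ε hε
    obtain ⟨K, hK⟩ := hu ε hε
    refine ⟨K, fun n hn ↦ key ε n ?_⟩
    filter_upwards [Filter.eventually_ge_atTop K] with m hm using (hK m hm n hn).le
  have hmem : T ∈ gammaSubmodule H X := by
    intro ε hε
    obtain ⟨K, hK⟩ := key' (ε / 2) (ENNReal.half_pos hε.ne')
    obtain ⟨N, h, x, hx⟩ := (u K).2 (ε / 2) (ENNReal.half_pos hε.ne')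
    refine ⟨N, h, x, ?_⟩
    have hfin : gammaNorm (T - toOp H X (u K)) ≠ ∞ := by
      obtain ⟨K', hK'⟩ := key' 1 one_pos
      have h1 := gammaNorm_add_le (T - toOp H X (u (max K' K)))
        (toOp H X (u (max K' K)) - toOp H X (u K))
      rw [sub_add_sub_cancel] at h1
      refine ne_top_of_le_ne_top (ENNReal.add_ne_top.2
        ⟨ne_top_of_le_ne_top ENNReal.one_ne_top (hK' _ (le_max_left _ _)), ?_⟩) h1
      rw [← map_sub]
      exact gammaNorm_toOp_ne_top _
    calc gammaNorm (T - tensorOp h x)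
        = gammaNorm ((T - toOp H X (u K)) + (toOp H X (u K) - tensorOp h x)) := by
          rw [sub_add_sub_cancel]
      _ ≤ _ := gammaNorm_add_le _ _
      _ < ε / 2 + ε / 2 := ENNReal.add_lt_add_of_le_of_lt hfin (hK K le_rfl) hx
      _ = ε := ENNReal.add_halves ε
  let R : Gamma H X := ⟨T, hmem⟩
  have hR : toOp H X R = T := rfl
  refine ⟨R, ?_⟩
  rw [EMetric.tendsto_atTop]
  intro ε hε
  obtain ⟨δ, hδ, hδε⟩ := exists_between hε
  obtain ⟨K, hK⟩ := key' δ hδ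
  refine ⟨K, fun n hn ↦ lt_of_le_of_lt ?_ hδε⟩
  rw [edist_comm, edist_eq_enorm_sub, enorm_def, map_sub, hR]
  exact hK n hn

end Gamma

/-! ### Functions defining elements of `γ(L², X)` -/

variable {S : Type*} [MeasurableSpace S]

/-- The strongly measurable function `f` defines the element `R` of `γ(L²(μ), X)`: the scalar
functions `⟨f, x*⟩` are in `L²(μ)`, and `R` is the Pettis integral operator `g ↦ ∫ f g ∂μ`. -/
def Defines (μ : Measure S) (f : S → X) (R : Gamma (Lp ℝ 2 μ) X) : Prop :=
  AEStronglyMeasurable f μ ∧ (∀ φ : X →L[ℝ] ℝ, MemLp (fun s ↦ φ (f s)) 2 μ) ∧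
    ∀ (g : Lp ℝ 2 μ) (φ : X →L[ℝ] ℝ),
      φ (Gamma.toOp (Lp ℝ 2 μ) X R g) = ∫ s, φ (g s • f s) ∂μ

/-- `f` represents the element `∑ₙ hₙ ⊗ xₙ` of `L²(μ) ⊗ X`. -/
def IsTensor (μ : Measure S) {N : ℕ} (h : Fin N → Lp ℝ 2 μ) (x : Fin N → X) (f : S → X) : Prop :=
  f =ᵐ[μ] fun s ↦ ∑ n, h n s • x n

end Gamma

/-! ### The integral operators -/

/-- Lebesgue measure on the interval `(0, T)`. -/
def volI (T : ℝ) : Measure ℝ := volume.restrict (Ioo 0 T)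

/-- The triangle `Δ = {(s, t) ∈ (0, T) × (0, T) : s ≤ t}`. -/
def triangle (T : ℝ) : Set (ℝ × ℝ) := {p | 0 < p.1 ∧ p.1 ≤ p.2 ∧ p.2 < T}

/-- Lebesgue measure on the triangle `Δ`. -/
def volTri (T : ℝ) : Measure (ℝ × ℝ) := volume.restrict (triangle T)

/-- `γ(0, T; X) = γ(L²(0, T), X)`. -/
abbrev GammaI (T : ℝ) (X : Type*) [NormedAddCommGroup X] [NormedSpace ℝ X] : Type _ :=
  Gamma (Lp ℝ 2 (volI T)) X

/-- `γ(Δ; X) = γ(L²(Δ), X)`. -/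
abbrev GammaTri (T : ℝ) (X : Type*) [NormedAddCommGroup X] [NormedSpace ℝ X] : Type _ :=
  Gamma (Lp ℝ 2 (volTri T)) X

section Operators

variable {X Y : Type*} [NormedAddCommGroup X] [NormedSpace ℝ X]
  [NormedAddCommGroup Y] [NormedSpace ℝ Y]

/-- `t ↦ ∫₀ᵗ M(t - s) f(s) ds`. -/
def convInt (M : ℝ → X →L[ℝ] Y) (f : ℝ → X) (t : ℝ) : Y := ∫ s in (0 : ℝ)..t, M (t - s) (f s)

/-- `t ↦ ∫₀ᵗ M(s, t) f(s, t) ds`. -/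
def triInt (M : ℝ × ℝ → X →L[ℝ] Y) (f : ℝ × ℝ → X) (t : ℝ) : Y :=
  ∫ s in (0 : ℝ)..t, M (s, t) (f (s, t))

end Operators

/-- `Y` contains a closed subspace isomorphic to `c₀`. -/
def ContainsCZero (Y : Type*) [NormedAddCommGroup Y] [NormedSpace ℝ Y] : Prop :=
  ∃ Z : Submodule ℝ Y, IsClosed (Z : Set Y) ∧
    Nonempty (ZeroAtInftyContinuousMap ℕ ℝ ≃L[ℝ] Z)

end GammaRad

end

/-!
Both operators are compositions of bounded operators between `γ`-spaces. Let `J` be composition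
with `(s, t) ↦ t`, a bounded operator from `L²(0, T)` to `L²(Δ)` of norm at most `√T`. The Pettis
operator of `t ↦ ∫₀ᵗ M(s, t) f(s, t) ds` is, by Fubini's theorem, the Pettis operator of the
function `M f` on `Δ` composed with `J` from the right (`exists_triInt_operator`). The convolution
`∫₀ᵗ M(t - s) f(s) ds` is the case of the kernel `M(t - s)` and of functions of `s` alone; these
come from `γ(0, T; X)` by composition with the adjoint of a second operator of norm at most `√T`
(`exists_convInt_operator`). Hence the constants `√T` and `√T · √T = T`. Right composition is
bounded by the right ideal property `gammaNorm_comp_le`, which holds because the adjoint of a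
contraction maps an orthonormal family to the compression of an orthonormal family in a larger
space.

What remains is the `γ`-multiplier theorem `exists_multiplier`. For finitely valued `M` it is the
definition of `γ`-boundedness, applied to orthonormal systems adapted to the level sets of `M`
(`gammaNorm_sum_tensorOp_le`). In general, `M` is approximated pointwise by finitely valued
functions with values in the same family, and the `γ`-norm, a supremum over finite orthonormal
systems, is lower semicontinuous (`gammaNorm_le_of_tendsto`). This bounds the `γ`-norm of the
limit, but does not put it in the closure of the finite rank operators, which is where the
hypothesis on `c₀` enters.

If an operator `T` with finite `γ`-norm is not a limit of finite rank operators, there are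
infinitely many orthogonal blocks of orthonormal vectors on which the Gaussian norm of `T` is
bounded below (`exists_orthonormal_blocks`). The block sums of the corresponding Gaussian series
form a series of symmetric random vectors with bounded second moments of the partial sums, whose
terms do not become small in probability by Fernique's theorem
(`exists_gaussianNorm_le_of_smallBall`). With positive probability a sample `z` has infinitely
many terms away from zero and bounded sign averages of `‖∑ ε_j z_j‖²`. By Bessel's inequality for
the first-order Walsh coefficients, all but finitely many terms can be given either sign at almost
no cost, which selects a subsequence with bounded signed sums
(`exists_subseq_bounded_signed_sums`). By the Bessaga–Pełczyński argument, with Rosenthal's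
disjointification lemma, a further subsequence is equivalent to the unit vector basis of `c₀`
(`containsCZero_of_bounded_signed_sums`).
-/

namespace GammaRad

/-! ### The right ideal property -/

section Ideal

variable {H H' : Type*} [NormedAddCommGroup H] [InnerProductSpace ℝ H]
  [NormedAddCommGroup H'] [InnerProductSpace ℝ H']
  {X Y : Type*} [NormedAddCommGroup X] [NormedSpace ℝ X] [NormedAddCommGroup Y] [NormedSpace ℝ Y]

lemma exists_orthonormal_expansion {N : ℕ} (h : Fin N → H) :
    ∃ (K : ℕ) (b : Fin K → H), Orthonormal ℝ b ∧ (∀ m, b m ∈ Submodule.span ℝ (range h)) ∧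
      ∀ v ∈ Submodule.span ℝ (range h), ∑ m, ⟪b m, v⟫_ℝ • b m = v := by
  let V : Submodule ℝ H := Submodule.span ℝ (range h)
  have : FiniteDimensional ℝ V := FiniteDimensional.span_of_finite ℝ (finite_range h)
  let b := stdOrthonormalBasis ℝ V
  refine ⟨_, fun m ↦ (b m : H), ?_, fun m ↦ (b m).2, fun v hv ↦ ?_⟩
  · have := b.orthonormal
    rw [orthonormal_iff_ite] at this ⊢
    exact this
  · have := congrArg (Subtype.val) (b.sum_repr' ⟨v, hv⟩)
    simpa using this

/-- A finite rank operator factors through an orthonormal system spanning its data. -/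
lemma tensorOp_eq_of_expansion {N K : ℕ} {h : Fin N → H} {b : Fin K → H}
    (hb : ∀ n, ∑ m, ⟪b m, h n⟫_ℝ • b m = h n) (x : Fin N → X) :
    tensorOp h x = tensorOp b (fun m ↦ tensorOp h x (b m)) := by
  ext v
  simp only [tensorOp_apply, Finset.smul_sum, smul_smul]
  rw [Finset.sum_comm]
  refine Finset.sum_congr rfl fun n _ ↦ ?_
  rw [← Finset.sum_smul]
  congr 1
  conv_lhs => rw [← hb n]
  rw [sum_inner]
  refine Finset.sum_congr rfl fun m _ ↦ ?_
  rw [inner_smul_left, real_inner_comm (h n)]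
  simp [mul_comm]

lemma gammaNorm_comp_linearIsometry_le (T : H →L[ℝ] X) (U : H' →ₗᵢ[ℝ] H) :
    gammaNorm (T.comp U.toContinuousLinearMap) ≤ gammaNorm T :=
  gammaNorm_le fun _ _ he ↦ gaussianNorm_le_gammaNorm T (he.comp_linearIsometry U)

/-- A family `h` with `‖∑ cₘ hₘ‖² ≤ ∑ cₘ²` is the compression of an orthonormal family in a larger
Hilbert space; hence `gammaNorm_tensorOp` persists as an inequality. -/
lemma gammaNorm_tensorOp_le_of_contraction {K : ℕ} {h : Fin K → H}
    (hh : ∀ c : Fin K → ℝ, ‖∑ m, c m • h m‖ ^ 2 ≤ ∑ m, c m ^ 2) (y : Fin K → X) :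
    gammaNorm (tensorOp h y) ≤ gaussianNorm y := by
  -- The defect `1 - gram h` is positive semidefinite, hence itself a Gram matrix: that of the
  -- components to be added in an orthogonal summand.
  let M : Matrix (Fin K) (Fin K) ℝ := 1 - Matrix.gram ℝ h
  have hM : M.PosSemidef := by
    refine Matrix.PosSemidef.of_dotProduct_mulVec_nonneg ?_ fun c ↦ ?_
    · exact Matrix.isHermitian_one.sub (Matrix.isHermitian_gram ℝ h)
    · have h1 : star c ⬝ᵥ M.mulVec c = ∑ m, c m ^ 2 - ‖∑ m, c m • h m‖ ^ 2 := by
        rw [← real_inner_self_eq_norm_sq]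
        simp only [M, Matrix.sub_mulVec, Matrix.one_mulVec, dotProduct_sub, star_trivial]
        congr 1
        · simp [dotProduct, sq]
        · simp only [dotProduct, Matrix.mulVec, Matrix.gram_apply, sum_inner, inner_sum,
            inner_smul_left, inner_smul_right, Finset.mul_sum]
          refine Finset.sum_congr rfl fun i _ ↦ Finset.sum_congr rfl fun j _ ↦ ?_
          simp only [real_inner_comm (h i) (h j), conj_trivial]
          ring
      rw [h1]
      exact sub_nonneg.2 (hh c)
  obtain ⟨k, v, hv⟩ := Matrix.posSemidef_iff_eq_sum_vecMulVec.1 hM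
  let B : Fin K → EuclideanSpace ℝ (Fin k) := fun m ↦ WithLp.toLp 2 fun i ↦ v i m
  let h' : Fin K → WithLp 2 (H × EuclideanSpace ℝ (Fin k)) := fun m ↦ WithLp.toLp 2 (h m, B m)
  have hh' : Orthonormal ℝ h' := by
    rw [orthonormal_iff_ite]
    intro i j
    have h2 := congrFun (congrFun hv i) j
    simp only [M, Matrix.sub_apply, Matrix.gram_apply, Matrix.sum_apply, Matrix.vecMulVec_apply,
      Matrix.one_apply, star_trivial] at h2
    simp only [h', WithLp.prod_inner_apply, B, PiLp.inner_apply]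
    simp only [RCLike.inner_apply, conj_trivial]
    rw [sub_eq_iff_eq_add'.1 h2]
    simp [mul_comm]
  let U : H →ₗᵢ[ℝ] WithLp 2 (H × EuclideanSpace ℝ (Fin k)) :=
    { toFun := fun u ↦ WithLp.toLp 2 (u, 0)
      map_add' := fun a b ↦ by rw [← WithLp.toLp_add]; simp
      map_smul' := fun a b ↦ by rw [RingHom.id_apply, ← WithLp.toLp_smul]; simp
      norm_map' := fun a ↦ by simp }
  have h3 : tensorOp h y = (tensorOp h' y).comp U.toContinuousLinearMap := by
    ext u
    simp [h', U, WithLp.prod_inner_apply]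
  rw [h3, ← gammaNorm_tensorOp hh']
  exact gammaNorm_comp_linearIsometry_le _ _

variable [CompleteSpace H] [CompleteSpace H']

lemma tensorOp_comp {N : ℕ} (h : Fin N → H) (x : Fin N → X) (A : H' →L[ℝ] H) :
    (tensorOp h x).comp A = tensorOp (fun n ↦ A.adjoint (h n)) x := by
  ext v
  simp [ContinuousLinearMap.adjoint_inner_left]

/-- The right ideal property of the `γ`-norm. -/
theorem gammaNorm_comp_le (T : H →L[ℝ] X) (A : H' →L[ℝ] H) :
    gammaNorm (T.comp A) ≤ ‖A‖ₑ * gammaNorm T := by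
  rcases eq_or_ne A 0 with rfl | hA
  · simp
  have ha : 0 < ‖A‖ := norm_pos_iff.2 hA
  refine gammaNorm_le fun N e he ↦ ?_
  obtain ⟨K, b, hb, -, hbe⟩ := exists_orthonormal_expansion fun n ↦ A (e n)
  let A' : H' →L[ℝ] H := ‖A‖⁻¹ • A
  have hA' : ‖A'‖ = 1 := by simp [A', norm_smul, ha.ne']
  let S : H' →L[ℝ] X := (tensorOp b fun m ↦ T (b m)).comp A'
  have hS : gammaNorm S ≤ gammaNorm T := by
    rw [show S = _ from tensorOp_comp _ _ _]
    refine (gammaNorm_tensorOp_le_of_contraction (fun c ↦ ?_) _).trans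
      (gaussianNorm_le_gammaNorm T hb)
    have h1 : ∑ m, c m • A'.adjoint (b m) = A'.adjoint (∑ m, c m • b m) := by simp
    have h2 : ‖∑ m, c m • b m‖ ^ 2 = ∑ m, c m ^ 2 := by
      rw [← real_inner_self_eq_norm_sq, hb.inner_sum]
      simp [sq]
    rw [h1, ← h2]
    gcongr
    refine (A'.adjoint.le_opNorm _).trans ?_
    rw [LinearIsometryEquiv.norm_map, hA', one_mul]
  have hTA : (fun n ↦ T.comp A (e n)) = fun n ↦ ‖A‖ • S (e n) := by
    ext n
    have h1 : tensorOp b (fun m ↦ T (b m)) (A (e n)) = T (A (e n)) := by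
      conv_rhs => rw [← hbe (A (e n)) (Submodule.subset_span ⟨n, rfl⟩)]
      simp
    simp only [S, A', ContinuousLinearMap.comp_apply, smul_apply, map_smul, h1,
      smul_smul, mul_inv_cancel₀ ha.ne', one_smul]
  rw [hTA, gaussianNorm_smul, enorm_norm]
  exact mul_le_mul_right ((gaussianNorm_le_gammaNorm S he).trans hS) _

namespace Gamma

/-- Composition with a bounded operator `A : H' → H` from the right, `R ↦ R ∘ A`, as a bounded
operator from `γ(H, X)` to `γ(H', X)`. -/
noncomputable def compRight (A : H' →L[ℝ] H) : Gamma H X →L[ℝ] Gamma H' X :=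
  LinearMap.mkContinuous
    { toFun := fun R ↦ ⟨(toOp H X R).comp A, fun ε hε ↦ by
        obtain ⟨N, h, x, hx⟩ := R.2 (ε / (‖A‖ₑ + 1)) (ENNReal.div_pos hε.ne' (by simp))
        refine ⟨N, fun n ↦ A.adjoint (h n), x, ?_⟩
        rw [← tensorOp_comp, ← ContinuousLinearMap.sub_comp]
        calc _ ≤ ‖A‖ₑ * gammaNorm (toOp H X R - tensorOp h x) := gammaNorm_comp_le _ _
          _ ≤ (‖A‖ₑ + 1) * gammaNorm (toOp H X R - tensorOp h x) :=
            mul_le_mul_left le_self_add _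
          _ < ε := by
            rw [mul_comm]
            exact (ENNReal.lt_div_iff_mul_lt (by simp) (by simp)).1 hx⟩
      map_add' := fun R S ↦ Subtype.ext (by
        change (toOp H X (R + S)).comp A = (toOp H X R).comp A + (toOp H X S).comp A
        rw [map_add, ContinuousLinearMap.add_comp])
      map_smul' := fun c R ↦ Subtype.ext (by
        change (toOp H X (c • R)).comp A = c • (toOp H X R).comp A
        rw [map_smul, ContinuousLinearMap.smul_comp]) }
    ‖A‖ (fun R ↦ by
      have h1 : gammaNorm ((toOp H X R).comp A) ≤ ‖A‖ₑ * gammaNorm (toOp H X R) :=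
        gammaNorm_comp_le _ _
      have h2 := ENNReal.toReal_mono
        (ENNReal.mul_ne_top enorm_ne_top (gammaNorm_toOp_ne_top R)) h1
      rwa [ENNReal.toReal_mul, toReal_enorm] at h2)

@[simp] lemma toOp_compRight (A : H' →L[ℝ] H) (R : Gamma H X) :
    toOp H' X (compRight A R) = (toOp H X R).comp A := rfl

lemma norm_compRight_le (A : H' →L[ℝ] H) : ‖(compRight A : Gamma H X →L[ℝ] Gamma H' X)‖ ≤ ‖A‖ :=
  LinearMap.mkContinuous_norm_le _ (norm_nonneg _) _

lemma compRight_tensor (A : H' →L[ℝ] H) {N : ℕ} (h : Fin N → H) (x : Fin N → X) :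
    compRight A (tensor h x) = tensor (fun n ↦ A.adjoint (h n)) x :=
  toOp_injective (by simp [tensorOp_comp])

end Gamma

end Ideal

/-! ### Disjointification and copies of `c₀` -/

section CZero

/-- Rosenthal's disjointification lemma: a nonnegative infinite matrix with bounded row sums has an
infinite principal submatrix whose off-diagonal row sums are at most `ε`. If no member of a
partition of `ℕ` into infinitely many infinite sets works, one index from each member gives a
submatrix whose row sums have decreased by `ε`, which can happen only finitely often. -/
lemma exists_injective_forall_sum_le {ε : ℝ} (hε : 0 < ε) (p : ℕ) :
    ∀ a : ℕ → ℕ → ℝ, (∀ n m, 0 ≤ a n m) → (∀ n (F : Finset ℕ), ∑ m ∈ F, a n m ≤ p * ε) →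
      ∃ k : ℕ → ℕ, k.Injective ∧
        ∀ n (F : Finset ℕ), n ∉ F → ∑ m ∈ F, a (k n) (k m) ≤ ε := by
  induction p with
  | zero =>
    intro a _ h
    exact ⟨id, Function.injective_id, fun n F _ ↦ (h n F).trans (by simp [hε.le])⟩
  | succ p ih =>
    intro a ha h
    by_cases hc : ∃ j, ∀ i (F : Finset ℕ), i ∉ F →
        ∑ m ∈ F, a (Nat.pair j i) (Nat.pair j m) ≤ ε
    · obtain ⟨j, hj⟩ := hc
      exact ⟨Nat.pair j, fun x y hxy ↦ (Nat.pair_eq_pair.1 hxy).2, hj⟩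
    · push Not at hc
      choose i F hiF hF using hc
      have hn : Function.Injective fun j ↦ Nat.pair j (i j) :=
        fun x y hxy ↦ (Nat.pair_eq_pair.1 hxy).1
      have hG : ∀ j (G : Finset ℕ),
          ∑ l ∈ G, a (Nat.pair j (i j)) (Nat.pair l (i l)) ≤ p * ε := by
        intro j G
        have hd : Disjoint (G.image fun l ↦ Nat.pair l (i l)) ((F j).image (Nat.pair j)) := by
          rw [Finset.disjoint_left]
          intro q hq hq'
          obtain ⟨l, -, rfl⟩ := Finset.mem_image.1 hq
          obtain ⟨m, hm, hml⟩ := Finset.mem_image.1 hq'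
          obtain ⟨rfl, rfl⟩ := Nat.pair_eq_pair.1 hml
          exact hiF _ hm
        have h1 := h (Nat.pair j (i j))
          ((G.image fun l ↦ Nat.pair l (i l)) ∪ ((F j).image (Nat.pair j)))
        rw [Finset.sum_union hd, Finset.sum_image (fun x _ y _ hxy ↦ hn hxy),
          Finset.sum_image (fun x _ y _ hxy ↦ (Nat.pair_eq_pair.1 hxy).2)] at h1
        have h2 := hF j
        push_cast at h1
        linarith
      obtain ⟨k, hk, hkF⟩ := ih (fun j l ↦ a (Nat.pair j (i j)) (Nat.pair l (i l)))
        (fun _ _ ↦ ha _ _) hG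
      exact ⟨_, hn.comp hk, hkF⟩

variable {Y : Type*} [NormedAddCommGroup Y] [NormedSpace ℝ Y]

lemma sum_abs_dual_le {z : ℕ → Y} {C : ℝ}
    (hz : ∀ (F : Finset ℕ) (η : ℕ → ℝ), (∀ i, η i = 1 ∨ η i = -1) → ‖∑ i ∈ F, η i • z i‖ ≤ C)
    {φ : Y →L[ℝ] ℝ} (hφ : ‖φ‖ ≤ 1) (F : Finset ℕ) : ∑ i ∈ F, |φ (z i)| ≤ C := by
  let η : ℕ → ℝ := fun i ↦ if 0 ≤ φ (z i) then 1 else -1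
  have h1 : ∑ i ∈ F, |φ (z i)| = φ (∑ i ∈ F, η i • z i) := by
    rw [map_sum]
    refine Finset.sum_congr rfl fun i _ ↦ ?_
    by_cases h : 0 ≤ φ (z i)
    · simp [η, h, abs_of_nonneg]
    · simp [η, h, abs_of_neg (not_le.1 h)]
  rw [h1]
  calc φ (∑ i ∈ F, η i • z i) ≤ ‖φ (∑ i ∈ F, η i • z i)‖ := Real.le_norm_self _
    _ ≤ 1 * ‖∑ i ∈ F, η i • z i‖ := φ.le_of_opNorm_le hφ _
    _ ≤ C := by
      rw [one_mul]
      exact hz F η fun i ↦ by by_cases h : 0 ≤ φ (z i) <;> simp [η, h]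

/-- A series with bounded signed partial sums satisfies an upper `c₀`-estimate. -/
lemma norm_sum_smul_le {z : ℕ → Y} {C : ℝ}
    (hz : ∀ (F : Finset ℕ) (η : ℕ → ℝ), (∀ i, η i = 1 ∨ η i = -1) → ‖∑ i ∈ F, η i • z i‖ ≤ C)
    {r : ℝ} (hr : 0 ≤ r) {a : ℕ → ℝ} {F : Finset ℕ} (ha : ∀ i ∈ F, |a i| ≤ r) :
    ‖∑ i ∈ F, a i • z i‖ ≤ r * C := by
  obtain ⟨φ, hφ, hφx⟩ := exists_dual_vector'' ℝ (∑ i ∈ F, a i • z i)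
  have hφx' : φ (∑ i ∈ F, a i • z i) = ‖∑ i ∈ F, a i • z i‖ := hφx
  rw [← hφx', map_sum]
  calc ∑ i ∈ F, φ (a i • z i) ≤ ∑ i ∈ F, r * |φ (z i)| := by
        refine Finset.sum_le_sum fun i hi ↦ (le_abs_self _).trans ?_
        rw [map_smul, smul_eq_mul, abs_mul]
        exact mul_le_mul_of_nonneg_right (ha i hi) (abs_nonneg _)
    _ ≤ r * C := by
      rw [← Finset.mul_sum]
      exact mul_le_mul_of_nonneg_left (sum_abs_dual_le hz hφ F) hr

/-- The Bessaga–Pełczyński criterion: a series with bounded signed partial sums whose terms stay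
away from zero spans, along a subsequence, a copy of `c₀`. -/
theorem containsCZero_of_bounded_signed_sums [CompleteSpace Y] {z : ℕ → Y} {C δ : ℝ} (hδ : 0 < δ)
    (hzδ : ∀ i, δ ≤ ‖z i‖)
    (hz : ∀ (F : Finset ℕ) (η : ℕ → ℝ), (∀ i, η i = 1 ∨ η i = -1) → ‖∑ i ∈ F, η i • z i‖ ≤ C) :
    ContainsCZero Y := by
  have hC : 0 ≤ C := by simpa using hz ∅ (fun _ ↦ 1) (by simp)
  choose φ hφ hφz using fun i ↦ exists_dual_vector'' ℝ (z i)
  obtain ⟨p, hp⟩ := exists_nat_ge (C / (δ / 2))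
  rw [div_le_iff₀ (by positivity)] at hp
  obtain ⟨k, hk, hkF⟩ := exists_injective_forall_sum_le (half_pos hδ) p
    (fun n m ↦ |φ n (z m)|) (fun _ _ ↦ abs_nonneg _)
    (fun n F ↦ (sum_abs_dual_le hz (hφ n) F).trans hp)
  let w : ℕ → Y := fun n ↦ z (k n)
  have hw : ∀ {r : ℝ} (_ : 0 ≤ r) {a : ℕ → ℝ} {F : Finset ℕ} (_ : ∀ i ∈ F, |a i| ≤ r),
      ‖∑ i ∈ F, a i • w i‖ ≤ r * C := by
    refine norm_sum_smul_le fun F η hη ↦ ?_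
    have h1 := hz (F.image k) (η ∘ Function.invFun k) fun i ↦ hη _
    rw [Finset.sum_image fun x _ y _ hxy ↦ hk hxy] at h1
    simpa [w, Function.leftInverse_invFun hk _] using h1
  have hbd : ∀ (a : ZeroAtInftyContinuousMap ℕ ℝ) i, |a i| ≤ ‖a‖ := fun a i ↦
    a.toBCF.norm_coe_le_norm i
  have hsum : ∀ a : ZeroAtInftyContinuousMap ℕ ℝ, Summable fun n ↦ a n • w n := by
    intro a
    rw [summable_iff_vanishing_norm]
    intro ε hε
    have h1 := a.zero_at_infty'
    rw [Filter.cocompact_eq_cofinite, Metric.tendsto_nhds] at h1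
    have h2 := h1 (ε / (C + 1)) (by positivity)
    rw [Filter.eventually_cofinite] at h2
    refine ⟨h2.toFinset, fun t ht ↦ ?_⟩
    refine (hw (r := ε / (C + 1)) (by positivity) fun i hi ↦ ?_).trans_lt ?_
    · have := Finset.disjoint_left.1 ht hi
      simp only [Finite.mem_toFinset, mem_ofPred_eq, not_not, dist_zero_right] at this
      exact this.le
    · rw [div_mul_eq_mul_div, div_lt_iff₀ (by positivity)]
      nlinarith
  have hlow : ∀ (a : ZeroAtInftyContinuousMap ℕ ℝ) n,
      δ * |a n| - δ / 2 * ‖a‖ ≤ ‖∑' m, a m • w m‖ := by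
    intro a n
    refine ge_of_tendsto (hsum a).hasSum.norm ?_
    filter_upwards [Filter.eventually_ge_atTop {n}] with F hF
    have hn : n ∈ F := hF (Finset.mem_singleton_self n)
    have h1 : ‖φ (k n) (∑ m ∈ F, a m • w m)‖ ≤ 1 * ‖∑ m ∈ F, a m • w m‖ :=
      (φ (k n)).le_of_opNorm_le (hφ _) _
    have h2 : φ (k n) (∑ m ∈ F, a m • w m) =
        a n * ‖z (k n)‖ + ∑ m ∈ F.erase n, a m * φ (k n) (w m) := by
      rw [map_sum, ← Finset.add_sum_erase _ _ hn, map_smul,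
        show φ (k n) (w n) = ‖z (k n)‖ from hφz (k n)]
      simp
    have h3 : |∑ m ∈ F.erase n, a m * φ (k n) (w m)| ≤ δ / 2 * ‖a‖ := by
      refine (Finset.abs_sum_le_sum_abs _ _).trans ?_
      calc ∑ m ∈ F.erase n, |a m * φ (k n) (w m)|
          ≤ ∑ m ∈ F.erase n, ‖a‖ * |φ (k n) (w m)| := by
            refine Finset.sum_le_sum fun m _ ↦ ?_
            rw [abs_mul]
            exact mul_le_mul_of_nonneg_right (hbd a m) (abs_nonneg _)
        _ ≤ δ / 2 * ‖a‖ := by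
          rw [← Finset.mul_sum, mul_comm]
          exact mul_le_mul_of_nonneg_right (hkF n _ (by simp)) (norm_nonneg _)
    rw [h2, one_mul, Real.norm_eq_abs] at h1
    have h4 : δ * |a n| ≤ |a n * ‖z (k n)‖| := by
      rw [abs_mul, abs_norm, mul_comm]
      exact mul_le_mul_of_nonneg_left (hzδ _) (abs_nonneg _)
    have h5 := abs_sub_abs_le_abs_sub (a n * ‖z (k n)‖)
      (-∑ m ∈ F.erase n, a m * φ (k n) (w m))
    rw [abs_neg, sub_neg_eq_add] at h5
    linarith
  let L : ZeroAtInftyContinuousMap ℕ ℝ →L[ℝ] Y := LinearMap.mkContinuous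
    { toFun := fun a ↦ ∑' m, a m • w m
      map_add' := fun a b ↦ by
        simp only [ZeroAtInftyContinuousMap.add_apply, add_smul]
        exact (hsum a).tsum_add (hsum b)
      map_smul' := fun c a ↦ by
        simp only [ZeroAtInftyContinuousMap.smul_apply, smul_assoc, RingHom.id_apply]
        exact (hsum a).tsum_const_smul c } C (fun a ↦ by
      refine le_of_tendsto (hsum a).hasSum.norm (Filter.Eventually.of_forall fun F ↦ ?_)
      rw [mul_comm]
      exact hw (norm_nonneg a) fun i _ ↦ hbd a i)
  have hL : ∀ a, ‖a‖ ≤ 2 / δ * ‖L a‖ := by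
    intro a
    have h1 : ‖a‖ ≤ (‖L a‖ + δ / 2 * ‖a‖) / δ := by
      refine (BoundedContinuousFunction.norm_le (f := a.toBCF) (by positivity)).2 fun n ↦ ?_
      rw [le_div_iff₀ hδ]
      have := hlow a n
      change |a n| * δ ≤ ‖∑' m, a m • w m‖ + _
      linarith
    rw [le_div_iff₀ hδ] at h1
    rw [div_mul_eq_mul_div, le_div_iff₀ hδ]
    linarith
  have hanti : AntilipschitzWith (Real.toNNReal (2 / δ)) L :=
    AddMonoidHomClass.antilipschitz_of_bound L fun a ↦ by
      rw [Real.coe_toNNReal _ (by positivity)]; exact hL a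
  have hcl : IsClosed (range L) := hanti.isClosed_range L.uniformContinuous
  refine ⟨LinearMap.range L.toLinearMap, ?_, ⟨ContinuousLinearMap.equivRange hanti.injective hcl⟩⟩
  rw [LinearMap.coe_range]
  exact hcl

end CZero

/-! ### Sign averages and bounded signed sums -/

section SignAverages

variable {Y : Type*} [NormedAddCommGroup Y]

/-- The mean of `φ (w + ∑ ε_j z_j)`, `m ≤ j < m + k`, over all choices of signs `ε_j = ±1`. -/
noncomputable def signMean (z : ℕ → Y) : ℕ → ℕ → (Y → ℝ) → Y → ℝ
  | _, 0, φ, w => φ w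
  | m, k + 1, φ, w => (signMean z (m + 1) k φ (w + z m) + signMean z (m + 1) k φ (w - z m)) / 2

/-- The mean of `ε_j φ (w + ∑ ε_i z_i)`, `m ≤ i < m + k`, over all choices of signs: the `j`-th
first-order Walsh coefficient. -/
noncomputable def signCoeff (z : ℕ → Y) (φ : Y → ℝ) (j : ℕ) : ℕ → ℕ → Y → ℝ
  | _, 0, _ => 0
  | m, k + 1, w =>
    if j = m then (signMean z (m + 1) k φ (w + z m) - signMean z (m + 1) k φ (w - z m)) / 2
    else (signCoeff z φ j (m + 1) k (w + z m) + signCoeff z φ j (m + 1) k (w - z m)) / 2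

variable {z : ℕ → Y} {φ ψ : Y → ℝ}

lemma signMean_mono (h : ∀ w, φ w ≤ ψ w) (m k : ℕ) (w : Y) :
    signMean z m k φ w ≤ signMean z m k ψ w := by
  induction k generalizing m w with
  | zero => exact h w
  | succ k ih =>
    simp only [signMean]
    linarith [ih (m + 1) (w + z m), ih (m + 1) (w - z m)]

lemma signMean_translate (m k : ℕ) (v w : Y) :
    signMean z m k φ (w + v) = signMean z m k (fun u ↦ φ (u + v)) w := by
  induction k generalizing m w with
  | zero => rfl
  | succ k ih =>
    simp only [signMean]
    rw [← ih, ← ih, add_right_comm, sub_add_eq_add_sub]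

lemma signMean_const_add_mul (a b : ℝ) (m k : ℕ) (w : Y) :
    signMean z m k (fun u ↦ a + b * φ u) w = a + b * signMean z m k φ w := by
  induction k generalizing m w with
  | zero => rfl
  | succ k ih =>
    simp only [signMean]
    rw [ih, ih]
    ring

/-- Midpoint convexity, the only consequence of convexity that sign means involve. -/
def MidConvex (φ : Y → ℝ) : Prop := ∀ w v, φ w ≤ (φ (w + v) + φ (w - v)) / 2

lemma MidConvex.signMean (hφ : MidConvex φ) (m k : ℕ) : MidConvex (signMean z m k φ) := by
  induction k generalizing m with
  | zero => exact hφ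
  | succ k ih =>
    intro w v
    have h1 := ih (m + 1) (w + z m) v
    have h2 := ih (m + 1) (w - z m) v
    simp only [GammaRad.signMean]
    rw [show w + v + z m = w + z m + v by abel, show w + v - z m = w - z m + v by abel,
      show w - v + z m = w + z m - v by abel, show w - v - z m = w - z m - v by abel]
    linarith

lemma signMean_le_signMean_add_right (hφ : MidConvex φ) (m k l : ℕ) (w : Y) :
    signMean z m k φ w ≤ signMean z m (k + l) φ w := by
  induction k generalizing m w with
  | zero =>
    rw [zero_add]
    induction l generalizing m w with
    | zero => rfl
    | succ l ih => exact (ih (m + 1) w).trans ((hφ.signMean (m + 1) l) w (z m))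
  | succ k ih =>
    rw [add_right_comm]
    simp only [signMean]
    linarith [ih (m + 1) (w + z m), ih (m + 1) (w - z m)]

lemma signMean_le_signMean_zero (hφ : MidConvex φ) (m k : ℕ) (w : Y) :
    signMean z m k φ w ≤ signMean z 0 (m + k) φ w := by
  induction m generalizing k with
  | zero => rw [zero_add]
  | succ m ih =>
    refine ((hφ.signMean (m + 1) k) w (z m)).trans ?_
    have := ih (k + 1)
    rw [add_right_comm, add_assoc]
    exact this

/-- Bessel's inequality for the first-order Walsh coefficients. -/
lemma sq_signMean_add_sum_sq_signCoeff_le (m k : ℕ) (w : Y) :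
    signMean z m k φ w ^ 2 + ∑ j ∈ Finset.Ico m (m + k), signCoeff z φ j m k w ^ 2 ≤
      signMean z m k (fun u ↦ φ u ^ 2) w := by
  induction k generalizing m w with
  | zero => simp [signMean]
  | succ k ih =>
    have h1 := ih (m + 1) (w + z m)
    have h2 := ih (m + 1) (w - z m)
    rw [add_assoc, add_comm 1 k] at h1 h2
    rw [Finset.sum_eq_sum_Ico_succ_bot (by omega)]
    have h3 : ∑ j ∈ Finset.Ico (m + 1) (m + (k + 1)), signCoeff z φ j m (k + 1) w ^ 2 ≤
        (∑ j ∈ Finset.Ico (m + 1) (m + (k + 1)), signCoeff z φ j (m + 1) k (w + z m) ^ 2 +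
          ∑ j ∈ Finset.Ico (m + 1) (m + (k + 1)), signCoeff z φ j (m + 1) k (w - z m) ^ 2) / 2 := by
      rw [← Finset.sum_add_distrib, Finset.sum_div]
      refine Finset.sum_le_sum fun j hj ↦ ?_
      rw [signCoeff, if_neg (by have := (Finset.mem_Ico.1 hj).1; omega)]
      nlinarith [sq_nonneg (signCoeff z φ j (m + 1) k (w + z m) -
        signCoeff z φ j (m + 1) k (w - z m))]
    rw [signCoeff, if_pos rfl]
    simp only [signMean]
    linarith

/-- Fixing the sign `ε_j` and averaging out the earlier ones. -/
lemma signMean_succ_le (hφ : MidConvex φ) {m k j : ℕ} (hmj : m ≤ j) (hjk : j < m + k) (w : Y) :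
    signMean z (j + 1) (m + k - (j + 1)) φ (w + z j) ≤
        signMean z m k φ w + signCoeff z φ j m k w ∧
      signMean z (j + 1) (m + k - (j + 1)) φ (w - z j) ≤
        signMean z m k φ w - signCoeff z φ j m k w := by
  induction k generalizing m w with
  | zero => omega
  | succ k ih =>
    rcases hmj.eq_or_lt with rfl | hlt
    · rw [signCoeff, if_pos rfl, show m + (k + 1) - (m + 1) = k by omega]
      simp only [signMean]
      constructor <;> apply le_of_eq <;> ring
    · have h1 := ih (m := m + 1) hlt (by omega) (w + z m)
      have h2 := ih (m := m + 1) hlt (by omega) (w - z m)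
      rw [show m + 1 + k = m + (k + 1) by ring] at h1 h2
      have h3 := (hφ.signMean (z := z) (j + 1) (m + (k + 1) - (j + 1))) (w + z j) (z m)
      have h4 := (hφ.signMean (z := z) (j + 1) (m + (k + 1) - (j + 1))) (w - z j) (z m)
      rw [signCoeff, if_neg (by omega)]
      simp only [signMean]
      rw [show w + z j + z m = w + z m + z j by abel,
        show w + z j - z m = w - z m + z j by abel] at h3
      rw [show w - z j + z m = w + z m - z j by abel,
        show w - z j - z m = w - z m - z j by abel] at h4
      constructor <;> linarith [h1.1, h1.2, h2.1, h2.2]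

variable [NormedSpace ℝ Y]

lemma midConvex_norm : MidConvex (fun w : Y ↦ ‖w‖) := fun w v ↦ by
  have h : (2 : ℝ) • w = (w + v) + (w - v) := by rw [two_smul]; abel
  have h1 : 2 * ‖w‖ ≤ ‖w + v‖ + ‖w - v‖ := by
    calc 2 * ‖w‖ = ‖(2 : ℝ) • w‖ := by rw [norm_smul]; norm_num
      _ ≤ _ := by rw [h]; exact norm_add_le _ _
  change ‖w‖ ≤ (‖w + v‖ + ‖w - v‖) / 2
  linarith

lemma midConvex_norm_sq : MidConvex (fun w : Y ↦ ‖w‖ ^ 2) := fun w v ↦ by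
  have h := midConvex_norm w v
  have h0 := norm_nonneg w
  dsimp only at h ⊢
  nlinarith [sq_nonneg (‖w + v‖ - ‖w - v‖)]

/-- By Bessel's inequality all but finitely many coordinates nearly decouple: fixing the sign of
such a `z_j` either way raises the means at finitely many given points by at most `η`. -/
lemma exists_signMean_succ_le {P : ℕ → Prop} (hP : ∃ᶠ j in Filter.atTop, P j) {W : Set Y}
    (hW : W.Finite) {B : Y → ℝ}
    (hB : ∀ w ∈ W, ∀ m k, signMean z m k (fun u ↦ ‖u‖ ^ 2) w ≤ B w) {m : ℕ} {c η : ℝ} (hη : 0 < η)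
    (hc : ∀ w ∈ W, ∀ k, signMean z m k (fun u ↦ ‖u‖) w ≤ c) :
    ∃ j, m ≤ j ∧ P j ∧ ∀ w ∈ W, ∀ k, signMean z (j + 1) k (fun u ↦ ‖u‖) (w + z j) ≤ c + η ∧
      signMean z (j + 1) k (fun u ↦ ‖u‖) (w - z j) ≤ c + η := by
  by_contra! hcon
  have hbad : ∀ j, m ≤ j → P j → ∃ w ∈ W, ∃ k, ∀ n, j + 1 + k ≤ m + n →
      η ^ 2 ≤ signCoeff z (fun u ↦ ‖u‖) j m n w ^ 2 := by
    intro j hj hPj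
    obtain ⟨w, hw, k, hk⟩ := hcon j hj hPj
    refine ⟨w, hw, k, fun n hn ↦ ?_⟩
    have h1 := signMean_succ_le (z := z) midConvex_norm hj (by omega : j < m + n) w
    have h2 := hc w hw n
    have hm : ∀ v, signMean z (j + 1) k (fun u ↦ ‖u‖) v ≤
        signMean z (j + 1) (m + n - (j + 1)) (fun u ↦ ‖u‖) v := by
      intro v
      have := signMean_le_signMean_add_right (z := z) midConvex_norm (j + 1) k
        (m + n - (j + 1) - k) v
      rwa [show k + (m + n - (j + 1) - k) = m + n - (j + 1) by omega] at this
    have h3 : η ≤ |signCoeff z (fun u ↦ ‖u‖) j m n w| := by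
      by_cases h : signMean z (j + 1) k (fun u ↦ ‖u‖) (w + z j) ≤ c + η
      · have := hk h
        refine le_trans ?_ (neg_le_abs _)
        linarith [h1.2, hm (w - z j)]
      · refine le_trans ?_ (le_abs_self _)
        linarith [h1.1, hm (w + z j)]
    rw [← sq_abs (signCoeff _ _ _ _ _ _)]
    gcongr
  choose! w hw k hk using hbad
  have hinf : {j | P j ∧ m ≤ j}.Infinite :=
    Nat.frequently_atTop_iff_infinite.1 (hP.and_eventually (Filter.eventually_ge_atTop m))
  obtain ⟨L, hL⟩ := exists_nat_gt ((∑ w ∈ hW.toFinset, B w) / η ^ 2)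
  obtain ⟨J, hJ, hJL⟩ := hinf.exists_subset_card_eq L
  let n := J.sup fun j ↦ j + 1 + k j
  have hn : ∀ j ∈ J, j + 1 + k j ≤ m + n := fun j hj ↦
    (Finset.le_sup (f := fun j ↦ j + 1 + k j) hj).trans (Nat.le_add_left _ _)
  have h1 : ∑ v ∈ hW.toFinset, ∑ j ∈ Finset.Ico m (m + n),
      signCoeff z (fun u ↦ ‖u‖) j m n v ^ 2 ≤ ∑ v ∈ hW.toFinset, B v := by
    refine Finset.sum_le_sum fun v hv ↦ ?_
    have := sq_signMean_add_sum_sq_signCoeff_le (z := z) (φ := fun u ↦ ‖u‖) m n v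
    have h2 := hB v (hW.mem_toFinset.1 hv) m n
    linarith [sq_nonneg (signMean z m n (fun u ↦ ‖u‖) v)]
  have h2 : (L : ℝ) * η ^ 2 ≤ ∑ v ∈ hW.toFinset, ∑ j ∈ Finset.Ico m (m + n),
      signCoeff z (fun u ↦ ‖u‖) j m n v ^ 2 := by
    rw [Finset.sum_comm, ← hJL, ← nsmul_eq_mul, ← Finset.sum_const]
    refine (Finset.sum_le_sum fun j hj ↦ ?_).trans
      (Finset.sum_le_sum_of_subset_of_nonneg (s := J) (fun j hj ↦ ?_) fun _ _ _ ↦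
        Finset.sum_nonneg fun _ _ ↦ sq_nonneg _)
    · have hj' := hJ hj
      exact (hk j hj'.2 hj'.1 n (hn j hj)).trans (Finset.single_le_sum
        (f := fun v ↦ signCoeff z (fun u ↦ ‖u‖) j m n v ^ 2) (fun _ _ ↦ sq_nonneg _)
        (hW.mem_toFinset.2 (hw j hj'.2 hj'.1)))
    · have := hn j hj
      exact Finset.mem_Ico.2 ⟨(hJ hj).2, by omega⟩
  rw [div_lt_iff₀ (by positivity)] at hL
  linarith

/-- Kwapień's selection: if the sign means of `‖∑ ε_j z_j‖²` stay bounded, then along a subsequence,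
which may be taken inside any infinite set of indices, all signed sums are bounded. -/
theorem exists_subseq_bounded_signed_sums {P : ℕ → Prop} (hP : ∃ᶠ j in Filter.atTop, P j) {K : ℝ}
    (hK : ∀ k, signMean z 0 k (fun u ↦ ‖u‖ ^ 2) 0 ≤ K) :
    ∃ (s : ℕ → ℕ) (C : ℝ), (∀ i, P (s i)) ∧
      ∀ (F : Finset ℕ) (η : ℕ → ℝ), (∀ i, η i = 1 ∨ η i = -1) →
        ‖∑ i ∈ F, η i • z (s i)‖ ≤ C := by
  let B : Y → ℝ := fun w ↦ 2 * ‖w‖ ^ 2 + 2 * K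
  have hB : ∀ w m k, signMean z m k (fun u ↦ ‖u‖ ^ 2) w ≤ B w := by
    intro w m k
    have h1 : signMean z m k (fun u ↦ ‖u‖ ^ 2) (0 + w) ≤
        signMean z m k (fun u ↦ 2 * ‖w‖ ^ 2 + 2 * ‖u‖ ^ 2) 0 := by
      rw [signMean_translate]
      refine signMean_mono (fun u ↦ ?_) m k 0
      have := norm_add_le u w
      nlinarith [sq_nonneg (‖u‖ - ‖w‖), norm_nonneg (u + w)]
    rw [zero_add, signMean_const_add_mul] at h1
    have h2 := (signMean_le_signMean_zero (z := z) midConvex_norm_sq m k 0).trans (hK (m + k))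
    simp only [B]
    linarith
  have hK0 : 0 ≤ K := le_trans (by simp [signMean]) (hK 0)
  -- The bound on the means may grow by `2^{-(i+1)}` at step `i`, hence by `1` in total.
  let c : ℕ → ℝ := fun i ↦ √K + 1 - (1 / 2) ^ i
  let W' : Set Y → ℕ → Set Y := fun W j ↦ (fun w ↦ w + z j) '' W ∪ (fun w ↦ w - z j) '' W
  let Q : ℕ → ℕ × Set Y → Prop := fun i p ↦ p.2.Finite ∧
    ∀ w ∈ p.2, ∀ k, signMean z p.1 k (fun u ↦ ‖u‖) w ≤ c i
  have hstep : ∀ i p, Q i p → ∃ j, P j ∧ Q (i + 1) (j + 1, W' p.2 j) := by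
    rintro i ⟨m, W⟩ ⟨hW, hc⟩
    obtain ⟨j, -, hPj, hj⟩ := exists_signMean_succ_le hP hW (fun w _ ↦ hB w)
      (η := (1 / 2) ^ (i + 1)) (by positivity) hc
    have hci : c i + (1 / 2) ^ (i + 1) = c (i + 1) := by simp only [c]; ring
    rw [hci] at hj
    refine ⟨j, hPj, (hW.image _).union (hW.image _), ?_⟩
    rintro _ (⟨w, hw, rfl⟩ | ⟨w, hw, rfl⟩) k
    · exact (hj w hw k).1
    · exact (hj w hw k).2
  choose! g hgP hgQ using hstep
  let p : ℕ → ℕ × Set Y := fun i ↦ Nat.rec (0, {0}) (fun i p ↦ (g i p + 1, W' p.2 (g i p))) i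
  have hp : ∀ i, Q i (p i) := by
    intro i
    induction i with
    | zero =>
      refine ⟨finite_singleton 0, ?_⟩
      rintro _ rfl k
      have h1 := sq_signMean_add_sum_sq_signCoeff_le (z := z) (φ := fun u ↦ ‖u‖) 0 k 0
      have h2 : 0 ≤ ∑ j ∈ Finset.Ico 0 (0 + k), signCoeff z (fun u ↦ ‖u‖) j 0 k 0 ^ 2 :=
        Finset.sum_nonneg fun _ _ ↦ sq_nonneg _
      have h3 : signMean z 0 k (fun u ↦ ‖u‖) 0 ≤ √K :=
        Real.le_sqrt_of_sq_le (by linarith [hK k])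
      change signMean z 0 k (fun u ↦ ‖u‖) 0 ≤ √K + 1 - (1 / 2) ^ 0
      rw [pow_zero]
      linarith
    | succ i ih => exact hgQ i (p i) ih
  let s : ℕ → ℕ := fun i ↦ g i (p i)
  have hmem : ∀ η : ℕ → ℝ, (∀ i, η i = 1 ∨ η i = -1) → ∀ n,
      ∑ i ∈ Finset.range n, η i • z (s i) ∈ (p n).2 := by
    intro η hη n
    induction n with
    | zero => simp [p]
    | succ n ih =>
      rw [Finset.sum_range_succ]
      rcases hη n with h | h <;> rw [h]
      · exact Or.inl ⟨_, ih, by rw [one_smul]⟩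
      · exact Or.inr ⟨_, ih, by rw [neg_one_smul, ← sub_eq_add_neg]⟩
  have hfull : ∀ η : ℕ → ℝ, (∀ i, η i = 1 ∨ η i = -1) → ∀ n,
      ‖∑ i ∈ Finset.range n, η i • z (s i)‖ ≤ √K + 1 := by
    intro η hη n
    have := (hp n).2 _ (hmem η hη n) 0
    simp only [signMean, c] at this
    linarith [pow_pos (by norm_num : (0 : ℝ) < 1 / 2) n]
  refine ⟨s, √K + 1, fun i ↦ hgP i (p i) (hp i), fun F η hη ↦ ?_⟩
  -- A partial sum over `F` is the midpoint of two full sums, with opposite signs off `F`.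
  obtain ⟨n, hn⟩ := F.exists_nat_subset_range
  let η' : ℕ → ℝ := fun i ↦ if i ∈ F then η i else -η i
  have h1 : ∑ i ∈ F, η i • z (s i) = (1 / 2 : ℝ) • (∑ i ∈ Finset.range n, η i • z (s i) +
      ∑ i ∈ Finset.range n, η' i • z (s i)) := by
    rw [← Finset.sum_add_distrib, Finset.smul_sum, ← Finset.sum_subset hn]
    · refine Finset.sum_congr rfl fun i hi ↦ ?_
      simp only [η', if_pos hi]
      rw [← two_smul ℝ, smul_smul]
      norm_num
    · intro i _ hi
      simp [η', if_neg hi]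
  rw [h1, norm_smul]
  have h2 := norm_add_le (∑ i ∈ Finset.range n, η i • z (s i))
    (∑ i ∈ Finset.range n, η' i • z (s i))
  have h3 := hfull η hη n
  have h4 := hfull η' (fun i ↦ by
    by_cases h : i ∈ F
    · simpa [η', h] using hη i
    · rcases hη i with h' | h' <;> simp [η', h, h']) n
  norm_num
  linarith

end SignAverages

/-! ### Symmetric and Gaussian series -/

section SymmetricSeries

variable {Y : Type*} [NormedAddCommGroup Y] {φ : Y → ℝ}

lemma signMean_nonneg {z : ℕ → Y} (hφ : ∀ y, 0 ≤ φ y) (m k : ℕ) (w : Y) :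
    0 ≤ signMean z m k φ w := by
  induction k generalizing m w with
  | zero => exact hφ w
  | succ k ih =>
    have h1 := ih (m + 1) (w + z m)
    have h2 := ih (m + 1) (w - z m)
    simp only [signMean]
    linarith

lemma continuous_signMean {Ω : Type*} [TopologicalSpace Ω] {u : ℕ → Ω → Y}
    (hu : ∀ j, Continuous (u j)) (hφ : Continuous φ) (k m : ℕ) {W : Ω → Y} (hW : Continuous W) :
    Continuous fun ω ↦ signMean (fun j ↦ u j ω) m k φ (W ω) := by
  induction k generalizing m W with
  | zero => exact hφ.comp hW
  | succ k ih =>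
    exact ((ih (m + 1) (hW.add (hu m))).add (ih (m + 1) (hW.sub (hu m)))).div_const 2

/-- For random vectors whose signs may be flipped one at a time without changing their joint law,
sign means preserve expectations. -/
lemma lintegral_signMean {Ω : Type*} [TopologicalSpace Ω] [MeasurableSpace Ω]
    [OpensMeasurableSpace Ω] {P : Measure Ω} {u : ℕ → Ω → Y} (hu : ∀ j, Continuous (u j))
    {σ : ℕ → Ω → Ω} (hσ : ∀ j, MeasurePreserving (σ j) P P)
    (hσu : ∀ j ω, u j (σ j ω) = -u j ω) (hσu' : ∀ j l ω, l ≠ j → u l (σ j ω) = u l ω)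
    (hφ : Continuous φ) (hφ0 : ∀ y, 0 ≤ φ y) (k m : ℕ) {W : Ω → Y}
    (hW : Continuous W) (hWσ : ∀ j, m ≤ j → ∀ ω, W (σ j ω) = W ω) :
    ∫⁻ ω, .ofReal (signMean (fun j ↦ u j ω) m k φ (W ω)) ∂P =
      ∫⁻ ω, .ofReal (φ (W ω + ∑ j ∈ Finset.Ico m (m + k), u j ω)) ∂P := by
  induction k generalizing m W with
  | zero => simp [signMean]
  | succ k ih =>
    have h1 := ih (m + 1) (hW.add (hu m)) (fun j hj ω ↦ by
      rw [Pi.add_apply, hWσ j (by omega), hσu' j m ω (by omega), Pi.add_apply])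
    have h2 := ih (m + 1) (hW.sub (hu m)) (fun j hj ω ↦ by
      rw [Pi.sub_apply, hWσ j (by omega), hσu' j m ω (by omega), Pi.sub_apply])
    simp only [Pi.add_apply, Pi.sub_apply] at h1 h2
    have hsum : ∀ ω, ∑ j ∈ Finset.Ico (m + 1) (m + 1 + k), u j (σ m ω) =
        ∑ j ∈ Finset.Ico (m + 1) (m + 1 + k), u j ω := fun ω ↦
      Finset.sum_congr rfl fun j hj ↦ hσu' m j ω (by have := (Finset.mem_Ico.1 hj).1; omega)
    have hmeas : Measurable fun ω ↦ ENNReal.ofReal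
        (φ (W ω + u m ω + ∑ j ∈ Finset.Ico (m + 1) (m + 1 + k), u j ω)) :=
      (ENNReal.continuous_ofReal.comp (hφ.comp ((hW.add (hu m)).add
        (continuous_finsetSum _ fun j _ ↦ hu j)))).measurable
    have h3 : ∫⁻ ω, .ofReal (φ (W ω - u m ω +
        ∑ j ∈ Finset.Ico (m + 1) (m + 1 + k), u j ω)) ∂P =
        ∫⁻ ω, .ofReal (φ (W ω + u m ω +
          ∑ j ∈ Finset.Ico (m + 1) (m + 1 + k), u j ω)) ∂P := by
      rw [← (hσ m).lintegral_comp hmeas]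
      refine lintegral_congr fun ω ↦ ?_
      rw [hσu, hsum, hWσ m le_rfl, sub_eq_add_neg]
    have h4 : ∀ ω, ENNReal.ofReal (signMean (fun j ↦ u j ω) m (k + 1) φ (W ω)) =
        2⁻¹ * (.ofReal (signMean (fun j ↦ u j ω) (m + 1) k φ (W ω + u m ω)) +
          .ofReal (signMean (fun j ↦ u j ω) (m + 1) k φ (W ω - u m ω))) := by
      intro ω
      rw [← ENNReal.ofReal_add (signMean_nonneg hφ0 _ _ _) (signMean_nonneg hφ0 _ _ _), signMean,
        div_eq_inv_mul, ENNReal.ofReal_mul (by norm_num), ENNReal.ofReal_inv_of_pos (by norm_num)]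
      simp
    simp only [h4]
    have h5 := ENNReal.continuous_ofReal.comp
      (continuous_signMean hu hφ k (m + 1) (hW.add (hu m)))
    have h6 := ENNReal.continuous_ofReal.comp
      (continuous_signMean hu hφ k (m + 1) (hW.sub (hu m)))
    rw [lintegral_const_mul _ (by exact (h5.add h6).measurable),
      lintegral_add_left (by exact h5.measurable),
      h1, h2, h3, ← two_mul, ← mul_assoc, ENNReal.inv_mul_cancel (by simp) (by simp), one_mul]
    refine lintegral_congr fun ω ↦ ?_
    rw [Finset.sum_eq_sum_Ico_succ_bot (by omega : m < m + (k + 1)), ← add_assoc,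
      show m + 1 + k = m + (k + 1) by ring]

end SymmetricSeries

section GaussianSeries

variable {Y : Type*} [NormedAddCommGroup Y] [NormedSpace ℝ Y]

/-- The small ball form of Fernique's theorem: the `L²`-norm of a Gaussian sum is controlled by the
radius of any ball that carries mass `3/4`, with a constant that depends on nothing. -/
theorem exists_gaussianNorm_le_of_smallBall :
    ∃ D : ℝ≥0, ∀ {Y : Type*} [NormedAddCommGroup Y] [NormedSpace ℝ Y] {N : ℕ} (y : Fin N → Y)
      {a : ℝ≥0}, 0 < a →
      3 / 4 ≤ (Measure.pi fun _ : Fin N ↦ gaussianReal 0 1) {g | ‖∑ n, g n • y n‖ ≤ a} →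
      gaussianNorm y ≤ D * a := by
  let c : ℝ≥0∞ := 3 / 4
  have hc2 : (2 : ℝ≥0∞)⁻¹ < c := by
    rw [← ENNReal.toReal_lt_toReal (by simp) (by simp [c, ENNReal.div_eq_top])]
    simp [c, ENNReal.toReal_div]
    norm_num
  have hc1 : c < 1 := by
    rw [← ENNReal.toReal_lt_toReal (by simp [c, ENNReal.div_eq_top]) (by simp)]
    simp [c, ENNReal.toReal_div]
    norm_num
  have hcr : c.toReal = 3 / 4 := by simp [c, ENNReal.toReal_div]
  have hcr' : (1 - c).toReal = 1 / 4 := by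
    rw [ENNReal.toReal_sub_of_le hc1.le (by simp), hcr]
    norm_num
  let ρ : ℝ := Fernique.logRatio c
  have hρ : 0 < ρ := Fernique.logRatio_pos hc2 hc1
  let E₀ : ℝ≥0∞ := .ofReal (Real.exp ρ) +
    ∑' n : ℕ, .ofReal (Real.exp (-2⁻¹ * Real.log (c / (1 - c)).toReal * 2 ^ n))
  have hE : E₀ ≠ ∞ := by
    refine (ENNReal.add_lt_top.mpr ⟨ENNReal.ofReal_lt_top, ?_⟩).ne
    refine Summable.tsum_ofReal_lt_top <|
      Real.summable_exp_nat_mul_of_ge ?_ (fun i ↦ mod_cast (Nat.lt_pow_self (by simp)).le)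
    refine mul_neg_of_neg_of_pos (by simp) (Real.log_pos ?_)
    rw [ENNReal.toReal_div, hcr, hcr']
    norm_num
  lift E₀ to ℝ≥0 using hE with E₁ hE₁
  refine ⟨(E₁ / ρ.toNNReal) ^ (1 / 2 : ℝ), fun {Y} _ _ {N} y {a} ha hsmall ↦ ?_⟩
  let V : Submodule ℝ Y := Submodule.span ℝ (range y)
  have : FiniteDimensional ℝ V := FiniteDimensional.span_of_finite ℝ (finite_range y)
  have : ProperSpace V := FiniteDimensional.proper ℝ V
  let _ : MeasurableSpace V := borel V
  have : BorelSpace V := ⟨rfl⟩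
  let y' : Fin N → V := fun n ↦ ⟨y n, Submodule.subset_span ⟨n, rfl⟩⟩
  let L : EuclideanSpace ℝ (Fin N) →L[ℝ] V := ∑ n, (EuclideanSpace.proj n).smulRight (y' n)
  have hL : ∀ w, L w = ∑ n, w n • y' n := fun w ↦ by simp [L]
  let μ : Measure V := (stdGaussian (EuclideanSpace ℝ (Fin N))).map L
  have hμ : IsGaussian μ := inferInstance
  have hμ' : μ = (Measure.pi fun _ : Fin N ↦ gaussianReal 0 1).map fun g ↦ ∑ n, g n • y' n := by
    simp only [μ]
    rw [← map_pi_eq_stdGaussian, Measure.map_map (by fun_prop) (by fun_prop)]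
    congr 1
    ext g
    simp [hL]
  have hmeas : Measurable fun g : Fin N → ℝ ↦ ∑ n, g n • y' n :=
    (by fun_prop : Continuous fun g : Fin N → ℝ ↦ ∑ n, g n • y' n).measurable
  have hnorm : ∀ g : Fin N → ℝ, ‖∑ n, g n • y' n‖ = ‖∑ n, g n • y n‖ := fun g ↦ by
    change ‖((∑ n, g n • y' n : V) : Y)‖ = _
    simp [y']
  have hrot := IsGaussian.map_rotation_eq_self_of_forall_strongDual_eq_zero (μ := μ)
    (fun Λ ↦ by
      simp only [μ]
      rw [integral_map (by fun_prop) (by fun_prop)]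
      exact integral_strongDual_stdGaussian (Λ.comp L)) (-(Real.pi / 4))
  have hball : c ≤ μ {x | ‖x‖ ≤ a} := by
    rw [hμ', Measure.map_apply hmeas (measurableSet_le (by fun_prop) (by fun_prop))]
    simpa only [preimage_ofPred_eq, hnorm] using hsmall
  have hF := lintegral_exp_mul_sq_norm_le_of_map_rotation_eq_self hrot hball hc2
  have hsq : ∫⁻ g : Fin N → ℝ, ‖∑ n, g n • y n‖ₑ ^ 2
      ∂(Measure.pi fun _ ↦ gaussianReal 0 1) = ∫⁻ x, ‖x‖ₑ ^ 2 ∂μ := by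
    rw [hμ', lintegral_map (by fun_prop) hmeas]
    refine lintegral_congr fun g ↦ ?_
    rw [← ofReal_norm, ← ofReal_norm, hnorm]
  have hpt : ∀ x : V, ENNReal.ofReal (ρ * (a : ℝ)⁻¹ ^ 2) * ‖x‖ₑ ^ 2 ≤
      .ofReal (Real.exp (ρ * (a : ℝ)⁻¹ ^ 2 * ‖x‖ ^ 2)) := by
    intro x
    rw [← ofReal_norm, ← ENNReal.ofReal_pow (norm_nonneg _), ← ENNReal.ofReal_mul (by positivity)]
    exact ENNReal.ofReal_le_ofReal ((by linarith : _ ≤ _ + (1 : ℝ)).trans (Real.add_one_le_exp _))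
  have h1 : ENNReal.ofReal (ρ * (a : ℝ)⁻¹ ^ 2) * ∫⁻ x, ‖x‖ₑ ^ 2 ∂μ ≤ E₁ := by
    rw [← lintegral_const_mul _ (by fun_prop), hE₁]
    exact (lintegral_mono hpt).trans hF
  have h2 : ENNReal.ofReal (ρ * (a : ℝ)⁻¹ ^ 2) = ((ρ.toNNReal * a⁻¹ ^ 2 : ℝ≥0) : ℝ≥0∞) := by
    rw [ENNReal.ofReal]
    congr 1
    rw [Real.toNNReal_mul hρ.le]
    congr 1
    rw [← NNReal.coe_inv, ← NNReal.coe_pow, Real.toNNReal_coe]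
  have hρ' : ρ.toNNReal ≠ 0 := (Real.toNNReal_pos.2 hρ).ne'
  have hne : ρ.toNNReal * a⁻¹ ^ 2 ≠ 0 := by positivity
  rw [gaussianNorm_eq_lintegral, hsq]
  rw [h2, mul_comm, ← ENNReal.le_div_iff_mul_le (by simp [hρ', ha.ne']) (by simp),
    ← ENNReal.coe_div hne] at h1
  refine (ENNReal.rpow_le_rpow h1 (by norm_num)).trans_eq ?_
  rw [← ENNReal.coe_rpow_of_nonneg _ (by norm_num), ← ENNReal.coe_mul]
  congr 1
  have h3 : E₁ / (ρ.toNNReal * a⁻¹ ^ 2) = E₁ / ρ.toNNReal * a ^ 2 := by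
    field_simp
  rw [h3, NNReal.mul_rpow, ← NNReal.rpow_natCast, ← NNReal.rpow_mul]
  norm_num

lemma map_eval_infinitePi_gaussian {ι : Type*} {N : ℕ} {k : Fin N → ι} (hk : k.Injective) :
    (Measure.infinitePi fun _ : ι ↦ gaussianReal 0 1).map (fun ω n ↦ ω (k n)) =
      Measure.pi fun _ : Fin N ↦ gaussianReal 0 1 := by
  have h1 : iIndepFun (fun (i : ι) (ω : ι → ℝ) ↦ ω i)
      (Measure.infinitePi fun _ : ι ↦ gaussianReal 0 1) := by
    rw [iIndepFun_iff_map_fun_eq_infinitePi_map (by fun_prop)]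
    simp [Measure.infinitePi_map_eval, Measure.map_id']
  have h2 := (iIndepFun_iff_map_fun_eq_pi_map
    fun n ↦ (measurable_pi_apply (k n)).aemeasurable).1 (h1.precomp hk)
  simpa [Measure.infinitePi_map_eval, Function.comp_def] using h2

lemma lintegral_infinitePi_gaussian {ι : Type*} {N : ℕ} {k : Fin N → ι} (hk : k.Injective)
    (y : Fin N → Y) :
    ∫⁻ ω : ι → ℝ, ‖∑ n, ω (k n) • y n‖ₑ ^ 2 ∂(Measure.infinitePi fun _ ↦ gaussianReal 0 1) =
      gaussianNorm y ^ 2 := by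
  have hm : Measurable fun g : Fin N → ℝ ↦ ‖∑ n, g n • y n‖ₑ ^ 2 :=
    (by fun_prop : Continuous fun g : Fin N → ℝ ↦ ‖∑ n, g n • y n‖ₑ ^ 2).measurable
  rw [gaussianNorm_eq_lintegral, ← ENNReal.rpow_natCast, ← ENNReal.rpow_mul,
    ← map_eval_infinitePi_gaussian hk, lintegral_map hm (by fun_prop)]
  simp

/-- A sample of a bounded random series with symmetric increments that do not become small in
probability is, with positive probability, a sequence to which
`exists_subseq_bounded_signed_sums` applies; hence such a series forces a copy of `c₀`. -/
lemma containsCZero_of_symmetric_series [CompleteSpace Y] {Ω : Type*} [TopologicalSpace Ω]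
    [MeasurableSpace Ω] [OpensMeasurableSpace Ω] {P : Measure Ω} [IsFiniteMeasure P]
    {u : ℕ → Ω → Y} (hu : ∀ j, Continuous (u j))
    {σ : ℕ → Ω → Ω} (hσ : ∀ j, MeasurePreserving (σ j) P P)
    (hσu : ∀ j ω, u j (σ j ω) = -u j ω) (hσu' : ∀ j l ω, l ≠ j → u l (σ j ω) = u l ω)
    {K : ℝ≥0∞} (hK : K ≠ ∞)
    (huK : ∀ n, ∫⁻ ω, ‖∑ j ∈ Finset.range n, u j ω‖ₑ ^ 2 ∂P ≤ K)
    {δ : ℝ} (hδ : 0 < δ) {c : ℝ≥0∞} (hc : c ≠ 0) (huc : ∀ j, c ≤ P {ω | δ ≤ ‖u j ω‖}) :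
    ContainsCZero Y := by
  let F : ℕ → Ω → ℝ≥0∞ := fun k ω ↦
    .ofReal (signMean (fun j ↦ u j ω) 0 k (fun y ↦ ‖y‖ ^ 2) 0)
  have hF : ∀ k, ∫⁻ ω, F k ω ∂P = ∫⁻ ω, ‖∑ j ∈ Finset.range k, u j ω‖ₑ ^ 2 ∂P := by
    intro k
    have := lintegral_signMean hu hσ hσu hσu' (φ := fun y ↦ ‖y‖ ^ 2) (by fun_prop)
      (fun y ↦ by positivity) k 0 (W := fun _ ↦ (0 : Y)) continuous_const (fun _ _ _ ↦ rfl)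
    simp only [F]
    rw [this]
    refine lintegral_congr fun ω ↦ ?_
    rw [zero_add, zero_add, ← Finset.range_eq_Ico, ENNReal.ofReal_pow (norm_nonneg _),
      ofReal_norm]
  have hFm : ∀ k, Measurable (F k) := fun k ↦ (ENNReal.continuous_ofReal.comp
    (continuous_signMean hu (by fun_prop) k 0 continuous_const)).measurable
  have hFmono : Monotone F := by
    refine monotone_nat_of_le_succ fun k ω ↦ ENNReal.ofReal_le_ofReal ?_
    exact signMean_le_signMean_add_right midConvex_norm_sq 0 k 1 0
  have hsup : ∫⁻ ω, ⨆ k, F k ω ∂P ≤ K := by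
    rw [lintegral_iSup hFm hFmono]
    exact iSup_le fun k ↦ (hF k).trans_le (huK k)
  have hfin : ∀ᵐ ω ∂P, ⨆ k, F k ω < ∞ :=
    ae_lt_top (Measurable.iSup hFm) (ne_top_of_le_ne_top hK hsup)
  let A : ℕ → Set Ω := fun n ↦ ⋃ j ≥ n, {ω | δ ≤ ‖u j ω‖}
  have hAm : ∀ n, MeasurableSet (A n) := fun n ↦ MeasurableSet.biUnion (to_countable _)
    fun j _ ↦ (isClosed_le continuous_const (hu j).norm).measurableSet
  have hAanti : Antitone A := fun n n' hnn ↦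
    biUnion_subset_biUnion_left fun j (hj : n' ≤ j) ↦ hnn.trans hj
  have hAc : c ≤ P (⋂ n, A n) := by
    refine ge_of_tendsto' (tendsto_measure_iInter_atTop (fun n ↦ (hAm n).nullMeasurableSet) hAanti
      ⟨0, measure_ne_top _ _⟩) fun n ↦ (huc n).trans (measure_mono ?_)
    exact subset_biUnion_of_mem (u := fun j ↦ {ω | δ ≤ ‖u j ω‖}) (le_refl n)
  obtain ⟨ω, hωA, hωF⟩ : ∃ ω, ω ∈ ⋂ n, A n ∧ ⨆ k, F k ω < ∞ := by
    by_contra! hcon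
    have h0 : P (⋂ n, A n) = 0 := by
      refine measure_mono_null (fun ω hω ↦ ?_) (ae_iff.1 hfin)
      exact not_lt.2 (hcon ω hω)
    exact hc (le_zero_iff.1 (h0 ▸ hAc))
  have hfreq : ∃ᶠ j in Filter.atTop, δ ≤ ‖u j ω‖ := by
    rw [Filter.frequently_atTop]
    intro n
    have := mem_iInter.1 hωA n
    simpa [A] using this
  have hbd : ∀ k, signMean (fun j ↦ u j ω) 0 k (fun y ↦ ‖y‖ ^ 2) 0 ≤ (⨆ k, F k ω).toReal :=
    fun k ↦ (ENNReal.ofReal_le_iff_le_toReal hωF.ne).1 (le_iSup (fun k ↦ F k ω) k)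
  obtain ⟨s, C, hs, hsC⟩ := exists_subseq_bounded_signed_sums hfreq hbd
  exact containsCZero_of_bounded_signed_sums hδ hs hsC

end GaussianSeries

/-! ### Operators of finite `γ`-norm into spaces without `c₀` -/

section HoffmannJorgensenKwapien

variable {H : Type*} [NormedAddCommGroup H] [InnerProductSpace ℝ H] [CompleteSpace H]
  {Y : Type*} [NormedAddCommGroup Y] [NormedSpace ℝ Y]

/-- An operator at `γ`-distance more than `ε` from all finite rank operators has, orthogonally to
any given finite-dimensional subspace, an orthonormal system on which its Gaussian norm
exceeds `ε`. -/
lemma exists_orthonormal_lt_gaussianNorm {T : H →L[ℝ] Y} {ε : ℝ≥0∞}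
    (hT : ∀ (N : ℕ) (h : Fin N → H) (x : Fin N → Y), ε < gammaNorm (T - tensorOp h x))
    {K : ℕ} (v : Fin K → H) :
    ∃ (N : ℕ) (b : Fin N → H), Orthonormal ℝ b ∧
      (∀ n, b n ∈ (Submodule.span ℝ (range v))ᗮ) ∧ ε < gaussianNorm fun n ↦ T (b n) := by
  let V : Submodule ℝ H := Submodule.span ℝ (range v)
  have : FiniteDimensional ℝ V := FiniteDimensional.span_of_finite ℝ (finite_range v)
  obtain ⟨M, c, hc, hcV, hcv⟩ := exists_orthonormal_expansion v
  have hP : ∀ w, ∑ m, ⟪c m, w⟫_ℝ • c m = V.starProjection w := by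
    intro w
    rw [← hcv _ (V.starProjection_apply_mem w)]
    refine Finset.sum_congr rfl fun m _ ↦ ?_
    have h1 := V.starProjection_inner_eq_zero w (c m) (hcV m)
    rw [real_inner_comm, inner_sub_right, sub_eq_zero] at h1
    rw [h1]
  have h1 := hT M c fun m ↦ T (c m)
  simp only [gammaNorm, lt_iSup_iff] at h1
  obtain ⟨L, e, he, heε⟩ := h1
  let w : Fin L → H := fun l ↦ Vᗮ.starProjection (e l)
  have hw : ∀ l, (T - tensorOp c fun m ↦ T (c m)) (e l) = T (w l) := by
    intro l
    simp only [w, Submodule.starProjection_orthogonal, sub_apply, map_sub, tensorOp_apply,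
      ContinuousLinearMap.id_apply]
    rw [← hP (e l)]
    simp
  obtain ⟨N, b, hb, hbw, hbe⟩ := exists_orthonormal_expansion w
  refine ⟨N, b, hb, fun n ↦ ?_, heε.trans_le ?_⟩
  · refine (Submodule.span_le.2 ?_) (hbw n)
    rintro _ ⟨l, rfl⟩
    exact Vᗮ.starProjection_apply_mem (e l)
  · have h2 : (fun l ↦ (T - tensorOp c fun m ↦ T (c m)) (e l)) =
        fun l ↦ ((tensorOp b fun n ↦ T (b n)).comp Vᗮ.starProjection) (e l) := by
      ext l
      rw [hw, ContinuousLinearMap.comp_apply, tensorOp_apply]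
      change T (w l) = ∑ n, ⟪b n, w l⟫_ℝ • T (b n)
      conv_lhs => rw [← hbe (w l) (Submodule.subset_span ⟨l, rfl⟩)]
      simp
    rw [h2, ← gammaNorm_tensorOp hb]
    refine (gaussianNorm_le_gammaNorm _ he).trans ((gammaNorm_comp_le _ _).trans ?_)
    refine mul_le_of_le_one_left zero_le ?_
    rw [← ofReal_norm]
    exact ENNReal.ofReal_le_one.2 Vᗮ.starProjection_norm_le

/-- The blocks are chosen one after the other, each orthogonal to the span of the previous ones. -/
lemma exists_orthonormal_blocks {T : H →L[ℝ] Y} {ε : ℝ≥0∞}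
    (hT : ∀ (N : ℕ) (h : Fin N → H) (x : Fin N → Y), ε < gammaNorm (T - tensorOp h x)) :
    ∃ (N : ℕ → ℕ) (b : ∀ j, Fin (N j) → H),
      Orthonormal ℝ (fun p : Σ j, Fin (N j) ↦ b p.1 p.2) ∧
      ∀ j, ε < gaussianNorm fun n ↦ T (b j n) := by
  choose N b hb hbv hbε using fun v : Σ K, Fin K → H ↦ exists_orthonormal_lt_gaussianNorm hT v.2
  let v : ℕ → Σ K, Fin K → H := fun j ↦ Nat.rec ⟨0, Fin.elim0⟩
    (fun _ v ↦ ⟨v.1 + N v, Fin.append v.2 (b v)⟩) j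
  have hv : ∀ j, range (v (j + 1)).2 = range (v j).2 ∪ range (b (v j)) := by
    intro j
    change range (Fin.append (v j).2 (b (v j))) = _
    ext x
    simp only [mem_range, mem_union]
    constructor
    · rintro ⟨i, rfl⟩
      exact Fin.addCases (fun i ↦ Or.inl ⟨i, by simp⟩) (fun i ↦ Or.inr ⟨i, by simp⟩) i
    · rintro (⟨i, rfl⟩ | ⟨i, rfl⟩)
      · exact ⟨Fin.castAdd _ i, by simp⟩
      · exact ⟨Fin.natAdd _ i, by simp⟩
  have hmem : ∀ j l, j < l → ∀ n, b (v j) n ∈ Submodule.span ℝ (range (v l).2) := by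
    intro j l hjl n
    induction l, hjl using Nat.le_induction with
    | base => exact Submodule.subset_span (by rw [hv]; exact Or.inr ⟨n, rfl⟩)
    | succ l _ ih => exact Submodule.span_mono (by rw [hv]; exact subset_union_left) ih
  refine ⟨fun j ↦ N (v j), fun j ↦ b (v j), ⟨fun p ↦ (hb (v p.1)).1 p.2, ?_⟩, fun j ↦ hbε (v j)⟩
  rintro ⟨j, n⟩ ⟨l, m⟩ hne
  rcases lt_trichotomy j l with h | rfl | h
  · exact (Submodule.mem_orthogonal _ _).1 (hbv (v l) m) _ (hmem j l h n)
  · exact (hb (v j)).2 fun h ↦ hne (congrArg (Sigma.mk j) h)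
  · rw [real_inner_comm]
    exact (Submodule.mem_orthogonal _ _).1 (hbv (v j) n) _ (hmem l j h m)

/-- In a space without copies of `c₀`, bounded Gaussian series converge; in operator form, a finite
`γ`-norm forces approximability by finite rank operators. Otherwise there are orthogonal blocks on
which the operator is bounded below, and the block sums of the corresponding Gaussian series are
bounded and, by Fernique's theorem, do not become small in probability. -/
theorem mem_gammaSubmodule_of_not_containsCZero [CompleteSpace Y] (hY : ¬ ContainsCZero Y)
    {T : H →L[ℝ] Y} (hT : gammaNorm T ≠ ∞) : T ∈ gammaSubmodule H Y := by
  by_contra hcon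
  have hcon' : ∃ ε : ℝ≥0∞, 0 < ε ∧
      ∀ (N : ℕ) (h : Fin N → H) (x : Fin N → Y), ε ≤ gammaNorm (T - tensorOp h x) := by
    by_contra! h
    exact hcon h
  obtain ⟨ε₀, hε₀, hTε₀⟩ := hcon'
  obtain ⟨ε, hε, hεε₀⟩ := ENNReal.lt_iff_exists_nnreal_btwn.1 hε₀
  obtain ⟨N, b, hb, hbε⟩ := exists_orthonormal_blocks
    (fun N h x ↦ hεε₀.trans_le (hTε₀ N h x))
  obtain ⟨D, hD⟩ := exists_gaussianNorm_le_of_smallBall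
  let ι := Σ j, Fin (N j)
  let P : Measure (ι → ℝ) := Measure.infinitePi fun _ ↦ gaussianReal 0 1
  let u : ℕ → (ι → ℝ) → Y := fun j ω ↦ ∑ n, ω ⟨j, n⟩ • T (b j n)
  have hu : ∀ j, Continuous (u j) := fun j ↦ by fun_prop
  let σ : ℕ → (ι → ℝ) → ι → ℝ := fun j ω p ↦ (if p.1 = j then -1 else 1) * ω p
  have hσ : ∀ j, MeasurePreserving (σ j) P P := by
    intro j
    refine ⟨by fun_prop, ?_⟩
    rw [Measure.infinitePi_map_pi (f := fun (p : ι) x ↦ (if p.1 = j then -1 else 1) * x) _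
      (fun p ↦ by fun_prop)]
    congr 1
    ext1 p
    by_cases h : p.1 = j
    · simp [h, gaussianReal_map_neg]
    · simp [h, Measure.map_id']
  -- `D * a < ε`, so a block sum cannot lie in the ball of radius `a` with probability `3/4`.
  let a : ℝ≥0 := ε / (D + 1)
  have hε' : 0 < ε := by exact_mod_cast hε
  have ha : 0 < a := by positivity
  have hDa : D * a < ε := by
    simp only [a]
    rw [mul_div_assoc', div_lt_iff₀ (by positivity)]
    rw [mul_add, mul_one, mul_comm]
    exact lt_add_of_pos_right _ hε'
  refine hY (containsCZero_of_symmetric_series (P := P) (u := u) hu hσ ?_ ?_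
    (K := gammaNorm T ^ 2) (ENNReal.pow_ne_top hT) ?_ (δ := a) ha (c := 1 / 4) (by simp) ?_)
  · intro j ω
    simp [u, σ]
  · intro j l ω hlj
    simp [u, σ, hlj]
  · intro n
    let s : Finset ι := (Finset.range n).sigma fun _ ↦ Finset.univ
    let e : Fin s.card ≃ s := s.equivFin.symm
    have hinj : Function.Injective fun i ↦ (e i : ι) := Subtype.val_injective.comp e.injective
    have h1 : ∀ ω : ι → ℝ, ∑ j ∈ Finset.range n, u j ω =
        ∑ i, ω (e i) • T (b (e i : ι).1 (e i : ι).2) := by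
      intro ω
      rw [e.sum_comp fun p : s ↦ ω p • T (b (p : ι).1 (p : ι).2),
        Finset.sum_coe_sort s fun p : ι ↦ ω p • T (b p.1 p.2), Finset.sum_sigma]
    simp only [h1]
    rw [lintegral_infinitePi_gaussian hinj]
    gcongr
    exact gaussianNorm_le_gammaNorm T (hb.comp _ hinj)
  · intro j
    have hinj : Function.Injective fun n : Fin (N j) ↦ (⟨j, n⟩ : ι) :=
      fun _ _ h ↦ by simpa [ι] using h
    have hmeas : MeasurableSet {ω | ‖u j ω‖ ≤ a} :=
      (isClosed_le (hu j).norm continuous_const).measurableSet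
    have h1 : P {ω | ‖u j ω‖ ≤ a} < 3 / 4 := by
      by_contra! h
      refine absurd (hD (fun n ↦ T (b j n)) ha ?_) (not_le.2 ((?_ : _ < (ε : ℝ≥0∞)).trans (hbε j)))
      · rw [← map_eval_infinitePi_gaussian hinj, Measure.map_apply (by fun_prop)
          (isClosed_le (by fun_prop) continuous_const).measurableSet]
        exact h
      · exact_mod_cast hDa
    have h2 : P {ω | ‖u j ω‖ ≤ a}ᶜ = 1 - P {ω | ‖u j ω‖ ≤ a} := prob_compl_eq_one_sub hmeas
    have h3 : (1 : ℝ≥0∞) / 4 ≤ P {ω | ‖u j ω‖ ≤ a}ᶜ := by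
      rw [h2]
      refine ENNReal.le_sub_of_add_le_left (measure_ne_top _ _) ?_
      calc P {ω | ‖u j ω‖ ≤ a} + 1 / 4 ≤ 3 / 4 + 1 / 4 := by gcongr
        _ = 1 := by
          rw [ENNReal.div_add_div_same]
          norm_num
          exact ENNReal.div_self (by simp) (by simp)
    refine h3.trans (measure_mono fun ω hω ↦ ?_)
    have : ¬ ‖u j ω‖ ≤ a := hω
    exact (not_le.1 this).le

end HoffmannJorgensenKwapien

/-! ### Finitely valued `γ`-multipliers -/

section Multiplier

variable {H : Type*} [NormedAddCommGroup H] [InnerProductSpace ℝ H]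
  {X Y : Type*} [NormedAddCommGroup X] [NormedSpace ℝ X] [NormedAddCommGroup Y] [NormedSpace ℝ Y]
  {𝒯 : Set (X →L[ℝ] Y)} {C : ℝ≥0}

lemma HasGammaBound.norm_le (h𝒯 : HasGammaBound 𝒯 C) {T : X →L[ℝ] Y} (hT : T ∈ 𝒯) : ‖T‖ ≤ C := by
  refine T.opNorm_le_bound C.2 fun x ↦ ?_
  have := h𝒯 1 (fun _ ↦ T) (fun _ ↦ x) fun _ ↦ hT
  rw [gaussianNorm_single, gaussianNorm_single, enorm_eq_nnnorm, enorm_eq_nnnorm] at this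
  exact_mod_cast this

lemma gammaNorm_le_of_tendsto {T : H →L[ℝ] Y} {R : ℕ → H →L[ℝ] Y} {B : ℝ≥0∞}
    (hR : ∀ k, gammaNorm (R k) ≤ B)
    (hRT : ∀ v, Filter.Tendsto (fun k ↦ R k v) Filter.atTop (nhds (T v))) : gammaNorm T ≤ B := by
  refine gammaNorm_le fun N e he ↦ ?_
  have hlim : Filter.Tendsto (fun k ↦ (∑ i, ‖T (e i) - R k (e i)‖ₑ) + B)
      Filter.atTop (nhds ((∑ i, ‖T (e i) - T (e i)‖ₑ) + B)) := by
    refine Filter.Tendsto.add (tendsto_finsetSum _ fun i _ ↦ ?_) tendsto_const_nhds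
    exact (continuous_enorm.tendsto _).comp (tendsto_const_nhds.sub (hRT _))
  simp only [sub_self, enorm_zero, Finset.sum_const_zero, zero_add] at hlim
  refine ge_of_tendsto' hlim fun k ↦ ?_
  calc gaussianNorm (fun i ↦ T (e i))
      = gaussianNorm (fun i ↦ (T (e i) - R k (e i)) + R k (e i)) := by simp
    _ ≤ _ := (gaussianNorm_add_le _ _).trans
        (add_le_add (gaussianNorm_le_sum _) ((gaussianNorm_le_gammaNorm _ he).trans (hR k)))

lemma sum_tensorOp_eq_tensorOp_sigma {κ : Type*} [Fintype κ] {K : κ → ℕ} {M : ℕ}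
    (b : ∀ i, Fin (K i) → H) (x : ∀ i, Fin (K i) → X) (e : Fin M ≃ Σ i, Fin (K i)) :
    ∑ i, tensorOp (b i) (x i) =
      tensorOp ((fun p : Σ i, Fin (K i) ↦ b p.1 p.2) ∘ e) fun q ↦ x (e q).1 (e q).2 := by
  ext v
  rw [sum_apply]
  simp only [tensorOp_apply, Function.comp_apply]
  rw [e.sum_comp fun p : Σ i, Fin (K i) ↦ ⟪b p.1 p.2, v⟫_ℝ • x p.1 p.2, Fintype.sum_sigma]

/-- Members of a `γ`-bounded family may be applied to orthogonal blocks of a finite rank operator: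
choosing orthonormal systems adapted to the blocks, this is the definition of `γ`-boundedness. -/
lemma gammaNorm_sum_tensorOp_le (h𝒯 : HasGammaBound 𝒯 C) {κ : Type*} [Fintype κ] {N : ℕ}
    {h : κ → Fin N → H} (hh : ∀ i j, i ≠ j → ∀ n m, ⟪h i n, h j m⟫_ℝ = 0)
    (x : Fin N → X) {S : κ → X →L[ℝ] Y} (hS : ∀ i, S i ∈ 𝒯) :
    gammaNorm (∑ i, tensorOp (h i) fun n ↦ S i (x n)) ≤
      C * gammaNorm (∑ i, tensorOp (h i) x) := by
  choose K b hb hbh hbe using fun i ↦ exists_orthonormal_expansion (h i)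
  have hperp : ∀ i j, i ≠ j → ∀ v ∈ Submodule.span ℝ (range (h i)),
      ∀ w ∈ Submodule.span ℝ (range (h j)), ⟪v, w⟫_ℝ = 0 := by
    intro i j hij v hv w hw
    have h1 : ∀ m, Submodule.span ℝ (range (h i)) ≤ (ℝ ∙ h j m)ᗮ := fun m ↦ by
      refine Submodule.span_le.2 ?_
      rintro _ ⟨n, rfl⟩
      exact Submodule.mem_orthogonal_singleton_iff_inner_left.2 (hh i j hij n m)
    have h2 : Submodule.span ℝ (range (h j)) ≤ (ℝ ∙ v)ᗮ := by
      refine Submodule.span_le.2 ?_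
      rintro _ ⟨m, rfl⟩
      exact Submodule.mem_orthogonal_singleton_iff_inner_right.2
        (Submodule.mem_orthogonal_singleton_iff_inner_left.1 (h1 m hv))
    exact Submodule.mem_orthogonal_singleton_iff_inner_right.1 (h2 hw)
  let y : (Σ i, Fin (K i)) → X := fun p ↦ tensorOp (h p.1) x (b p.1 p.2)
  let e := (Fintype.equivFin (Σ i, Fin (K i))).symm
  have hbo : Orthonormal ℝ fun p : Σ i, Fin (K i) ↦ b p.1 p.2 := by
    refine ⟨fun p ↦ (hb p.1).1 p.2, ?_⟩
    rintro ⟨i, n⟩ ⟨j, m⟩ hne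
    rcases eq_or_ne i j with rfl | hij
    · exact (hb i).2 fun h ↦ hne (congrArg (Sigma.mk i) h)
    · exact hperp i j hij _ (hbh i n) _ (hbh j m)
  have hbo' := hbo.comp e e.injective
  have h1 : ∀ i, tensorOp (h i) x = tensorOp (b i) fun m ↦ y ⟨i, m⟩ := fun i ↦
    tensorOp_eq_of_expansion (fun n ↦ hbe i _ (Submodule.subset_span ⟨n, rfl⟩)) x
  have h2 : ∀ i, tensorOp (h i) (fun n ↦ S i (x n)) = tensorOp (b i) fun m ↦ S i (y ⟨i, m⟩) := by
    intro i
    rw [tensorOp_eq_of_expansion (fun n ↦ hbe i _ (Submodule.subset_span ⟨n, rfl⟩))]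
    simp [y]
  simp only [h1, h2]
  rw [sum_tensorOp_eq_tensorOp_sigma b (fun i m ↦ y ⟨i, m⟩) e,
    sum_tensorOp_eq_tensorOp_sigma b (fun i m ↦ S i (y ⟨i, m⟩)) e, gammaNorm_tensorOp hbo',
    gammaNorm_tensorOp hbo']
  exact h𝒯 _ (fun q ↦ S (e q).1) (fun q ↦ y (e q)) fun q ↦ hS _

variable {S : Type*} [MeasurableSpace S] {μ : Measure S}

lemma integrable_Lp_mul (g h : Lp ℝ 2 μ) : Integrable (fun s ↦ g s * h s) μ := by
  simpa [mul_comm] using L2.integrable_inner (𝕜 := ℝ) g h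

lemma inner_Lp_eq_integral (g h : Lp ℝ 2 μ) : ⟪g, h⟫_ℝ = ∫ s, g s * h s ∂μ := by
  rw [L2.inner_def]
  simp [mul_comm]

/-- The multiplier estimate for finitely valued multipliers. -/
lemma exists_simple_multiplier [CompleteSpace Y] (h𝒯 : HasGammaBound 𝒯 C) {Z : Type*}
    (a : SimpleFunc S Z) {τ : Z → X →L[ℝ] Y} (hτ : ∀ s, τ (a s) ∈ 𝒯) {N : ℕ}
    (h : Fin N → Lp ℝ 2 μ) (x : Fin N → X) :
    ∃ R : Lp ℝ 2 μ →L[ℝ] Y, (∀ g, R g = ∫ s, g s • ∑ n, h n s • τ (a s) (x n) ∂μ) ∧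
      gammaNorm R ≤ C * gammaNorm (tensorOp h x) := by
  have hA : ∀ z, MeasurableSet (a ⁻¹' {z}) := fun z ↦ a.measurableSet_fiber z
  let χ : Z → Fin N → Lp ℝ 2 μ := fun z n ↦ ((Lp.memLp (h n)).indicator (hA z)).toLp _
  have hχ : ∀ z n, χ z n =ᵐ[μ] (a ⁻¹' {z}).indicator (h n) := fun z n ↦ MemLp.coeFn_toLp _
  have hsum : ∀ n, ∑ z : a.range, χ z n = h n := by
    intro n
    refine Lp.ext ?_
    have h1 : ∀ᵐ s ∂μ, ∀ z : a.range, χ z n s = (a ⁻¹' {(z : Z)}).indicator (h n) s :=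
      ae_all_iff.2 fun z ↦ hχ z n
    filter_upwards [h1, Lp.coeFn_finsetSum Finset.univ fun z : a.range ↦ χ z n] with s hs hs'
    rw [hs', Finset.sum_apply]
    simp only [hs]
    rw [Finset.sum_eq_single (⟨a s, a.mem_range_self s⟩ : a.range)]
    · simp
    · rintro ⟨z, hz⟩ - hne
      refine indicator_of_notMem ?_ _
      rintro rfl
      exact hne rfl
    · simp
  refine ⟨∑ z : a.range, tensorOp (χ z) fun n ↦ τ z (x n), fun g ↦ ?_, ?_⟩
  · have h1 : ∀ᵐ s ∂μ, ∀ (z : a.range) n, χ z n s = (a ⁻¹' {(z : Z)}).indicator (h n) s :=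
      ae_all_iff.2 fun z ↦ ae_all_iff.2 fun n ↦ hχ z n
    have h2 : (fun s ↦ g s • ∑ n, h n s • τ (a s) (x n)) =ᵐ[μ]
        fun s ↦ ∑ z : a.range, ∑ n, (χ z n s * g s) • τ z (x n) := by
      filter_upwards [h1] with s hs
      simp only [hs]
      rw [Finset.sum_eq_single (⟨a s, a.mem_range_self s⟩ : a.range)]
      · simp [Finset.smul_sum, smul_smul, mul_comm]
      · rintro ⟨z, hz⟩ - hne
        refine Finset.sum_eq_zero fun n _ ↦ ?_
        rw [indicator_of_notMem, zero_mul, zero_smul]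
        rintro rfl
        exact hne rfl
      · simp
    have h3 : ∀ (z : a.range) n, Integrable (fun s ↦ (χ z n s * g s) • τ z (x n)) μ :=
      fun z n ↦ (integrable_Lp_mul _ _).smul_const _
    rw [integral_congr_ae h2, integral_finsetSum _ fun z _ ↦
      integrable_finsetSum _ fun n _ ↦ h3 z n,
      sum_apply]
    refine Finset.sum_congr rfl fun z _ ↦ ?_
    rw [integral_finsetSum _ fun n _ ↦ h3 z n, tensorOp_apply]
    refine Finset.sum_congr rfl fun n _ ↦ ?_
    rw [integral_smul_const, inner_Lp_eq_integral]
  · have h4 : tensorOp h x = ∑ z : a.range, tensorOp (χ z) x := by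
      ext v
      rw [sum_apply]
      simp only [tensorOp_apply]
      rw [Finset.sum_comm]
      refine Finset.sum_congr rfl fun n _ ↦ ?_
      rw [← hsum n, sum_inner, Finset.sum_smul]
    rw [h4]
    refine gammaNorm_sum_tensorOp_le h𝒯 (fun z z' hne n m ↦ ?_) x fun z ↦ ?_
    · rw [inner_Lp_eq_integral]
      refine integral_eq_zero_of_ae ?_
      filter_upwards [hχ z n, hχ z' m] with s hs hs'
      rw [hs, hs']
      by_cases hz : a s = z
      · rw [indicator_of_notMem (s := a ⁻¹' {(z' : Z)}), mul_zero, Pi.zero_apply]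
        intro (hz' : a s = z')
        exact hne (Subtype.ext (hz.symm.trans hz'))
      · rw [indicator_of_notMem (s := a ⁻¹' {(z : Z)}), zero_mul, Pi.zero_apply]
        exact hz
    · obtain ⟨s, hs⟩ := SimpleFunc.mem_range.1 z.2
      rw [← hs]
      exact hτ s

end Multiplier

/-! ### The `γ`-multiplier theorem -/

section MultiplierOperator

variable {X Y : Type*} [NormedAddCommGroup X] [NormedSpace ℝ X] [NormedAddCommGroup Y]
  [NormedSpace ℝ Y] {𝒯 : Set (X →L[ℝ] Y)} {C : ℝ≥0}
  {S : Type*} [MeasurableSpace S] {μ : Measure S} {M : S → X →L[ℝ] Y}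

lemma memLp_multiplier (h𝒯 : HasGammaBound 𝒯 C) (hM : ∀ x, AEStronglyMeasurable (fun s ↦ M s x) μ)
    (hM𝒯 : ∀ᵐ s ∂μ, M s ∈ 𝒯) {N : ℕ} (h : Fin N → Lp ℝ 2 μ) (x : Fin N → X) :
    MemLp (fun s ↦ ∑ n, h n s • M s (x n)) 2 μ := by
  refine memLp_finsetSum _ fun n _ ↦ ?_
  refine (Lp.memLp (h n)).of_le_mul (c := C * ‖x n‖)
    ((Lp.aestronglyMeasurable (h n)).smul (hM (x n))) ?_
  filter_upwards [hM𝒯] with s hs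
  rw [norm_smul, mul_comm]
  exact mul_le_mul_of_nonneg_right ((M s).le_of_opNorm_le (h𝒯.norm_le hs) _) (norm_nonneg _)

lemma integrable_Lp_smul {w : S → Y} (hw : MemLp w 2 μ) (g : Lp ℝ 2 μ) :
    Integrable (fun s ↦ g s • w s) μ :=
  memLp_one_iff_integrable.1 (hw.smul (Lp.memLp g))

variable [CompleteSpace Y]

/-- The Pettis integral operator `g ↦ ∫ g w ∂μ` of a function `w ∈ L²(μ; Y)`. -/
noncomputable def pettisOp {w : S → Y} (hw : MemLp w 2 μ) : Lp ℝ 2 μ →L[ℝ] Y :=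
  ((ContinuousLinearMap.lsmul ℝ ℝ : ℝ →L[ℝ] Y →L[ℝ] Y).lpPairing μ 2 2).flip hw.toLp

lemma pettisOp_apply {w : S → Y} (hw : MemLp w 2 μ) (g : Lp ℝ 2 μ) :
    pettisOp hw g = ∫ s, g s • w s ∂μ := by
  rw [pettisOp, ContinuousLinearMap.flip_apply, ContinuousLinearMap.lpPairing_eq_integral]
  refine integral_congr_ae ?_
  filter_upwards [hw.coeFn_toLp] with s hs
  simp [hs]

/-- The `γ`-multiplier estimate. The multiplier is approximated pointwise by finitely valued ones
that take their values in the same `γ`-bounded family. -/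
theorem gammaNorm_multiplier_le (h𝒯 : HasGammaBound 𝒯 C)
    (hM : ∀ x, AEStronglyMeasurable (fun s ↦ M s x) μ) (hM𝒯 : ∀ᵐ s ∂μ, M s ∈ 𝒯)
    {N : ℕ} (h : Fin N → Lp ℝ 2 μ) (x : Fin N → X) {R : Lp ℝ 2 μ →L[ℝ] Y}
    (hR : ∀ g, R g = ∫ s, g s • ∑ n, h n s • M s (x n) ∂μ) :
    gammaNorm R ≤ C * gammaNorm (tensorOp h x) := by
  let _ : MeasurableSpace (Fin N → Y) := borel _
  have : BorelSpace (Fin N → Y) := ⟨rfl⟩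
  let F : S → Fin N → Y := fun s n ↦ M s (x n)
  have hF : AEStronglyMeasurable F μ := by
    have h1 : F = fun s ↦ ∑ n, Pi.single n (M s (x n)) := by
      ext1 s
      exact (Finset.univ_sum_single (F s)).symm
    rw [h1]
    exact Finset.aestronglyMeasurable_fun_sum _ fun n _ ↦
      (continuous_single n).comp_aestronglyMeasurable (hM (x n))
  let F' := hF.mk F
  have hF' : StronglyMeasurable F' := hF.stronglyMeasurable_mk
  let G : Set S := {s | M s ∈ 𝒯 ∧ F s = F' s}
  have hG : ∀ᵐ s ∂μ, s ∈ G := hM𝒯.and hF.ae_eq_mk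
  rcases G.eq_empty_or_nonempty with hG0 | ⟨s₀, hs₀⟩
  · have : R = 0 := by
      ext g
      rw [hR, zero_apply]
      exact integral_eq_zero_of_ae (hG.mono fun s hs ↦ absurd (hG0 ▸ hs) (notMem_empty s))
    simp [this]
  have hsep : TopologicalSpace.SeparableSpace (F' '' G) :=
    (hF'.isSeparable_range.mono (image_subset_range _ _)).separableSpace
  let a : ℕ → SimpleFunc S (Fin N → Y) :=
    SimpleFunc.approxOn F' hF'.measurable (F' '' G) (F' s₀) (mem_image_of_mem _ hs₀)
  have haG : ∀ k s, a k s ∈ F' '' G := fun k s ↦ SimpleFunc.approxOn_mem _ _ k s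
  have hτ : ∀ z ∈ F' '' G, ∃ T ∈ 𝒯, ∀ n, T (x n) = z n := by
    rintro _ ⟨s, hs, rfl⟩
    exact ⟨M s, hs.1, fun n ↦ congrFun hs.2 n⟩
  choose! τ hτ𝒯 hτx using hτ
  choose R' hR' hR'n using fun k ↦ exists_simple_multiplier h𝒯 (a k)
    (fun s ↦ hτ𝒯 _ (haG k s)) h x
  refine gammaNorm_le_of_tendsto hR'n fun g ↦ ?_
  rw [hR]
  simp only [hR']
  refine tendsto_integral_of_dominated_convergence
    (fun s ↦ ∑ n, |g s * h n s| * (C * ‖x n‖)) (fun k ↦ ?_) ?_ (fun k ↦ ?_) ?_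
  · refine (Lp.aestronglyMeasurable g).smul (Finset.aestronglyMeasurable_fun_sum _ fun n _ ↦
      (Lp.aestronglyMeasurable (h n)).smul ?_)
    have h1 : (fun s ↦ τ (a k s) (x n)) = ((a k).map fun z ↦ τ z (x n)) := by
      ext s
      simp
    rw [h1]
    exact (SimpleFunc.stronglyMeasurable _).aestronglyMeasurable
  · exact integrable_finsetSum _ fun n _ ↦ (integrable_Lp_mul g (h n)).abs.mul_const _
  · refine Filter.Eventually.of_forall fun s ↦ ?_
    rw [Finset.smul_sum]
    refine (norm_sum_le _ _).trans (Finset.sum_le_sum fun n _ ↦ ?_)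
    rw [smul_smul, norm_smul, Real.norm_eq_abs]
    exact mul_le_mul_of_nonneg_left
      ((τ (a k s)).le_of_opNorm_le (h𝒯.norm_le (hτ𝒯 _ (haG k s))) _) (abs_nonneg _)
  · filter_upwards [hG] with s hs
    have h1 : Filter.Tendsto (fun k ↦ a k s) Filter.atTop (nhds (F' s)) :=
      SimpleFunc.tendsto_approxOn _ _ (subset_closure (mem_image_of_mem _ hs))
    have h2 : ∀ n, Filter.Tendsto (fun k ↦ τ (a k s) (x n)) Filter.atTop (nhds (M s (x n))) := by
      intro n
      have h3 := tendsto_pi_nhds.1 h1 n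
      rw [← hs.2] at h3
      refine h3.congr fun k ↦ ?_
      rw [hτx _ (haG k s)]
    exact (tendsto_finsetSum _ fun n _ ↦ (h2 n).const_smul (h n s)).const_smul (g s)

/-- The `γ`-multiplier theorem: if `Y` does not contain `c₀`, pointwise multiplication by a strongly
measurable function `M` with values in a `γ`-bounded family extends from `L²(μ) ⊗ X` to a bounded
operator from `γ(L²(μ), X)` to `γ(L²(μ), Y)`. -/
theorem exists_multiplier (hY : ¬ ContainsCZero Y) (h𝒯 : HasGammaBound 𝒯 C)
    (hM : ∀ x, AEStronglyMeasurable (fun s ↦ M s x) μ) (hM𝒯 : ∀ᵐ s ∂μ, M s ∈ 𝒯) :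
    ∃ Θ : Gamma (Lp ℝ 2 μ) X →L[ℝ] Gamma (Lp ℝ 2 μ) Y, ‖Θ‖ ≤ C ∧
      ∀ (N : ℕ) (h : Fin N → Lp ℝ 2 μ) (x : Fin N → X) (g : Lp ℝ 2 μ),
        Gamma.toOp _ _ (Θ (Gamma.tensor h x)) g = ∫ s, g s • ∑ n, h n s • M s (x n) ∂μ := by
  have hmem := fun {N : ℕ} (h : Fin N → Lp ℝ 2 μ) (x : Fin N → X) ↦ memLp_multiplier h𝒯 hM hM𝒯 h x
  have hγ : ∀ {N : ℕ} (h : Fin N → Lp ℝ 2 μ) (x : Fin N → X),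
      gammaNorm (pettisOp (hmem h x)) ≤ C * gammaNorm (tensorOp h x) := fun h x ↦
    gammaNorm_multiplier_le h𝒯 hM hM𝒯 h x (pettisOp_apply _)
  let A : Lp ℝ 2 μ × X → Gamma (Lp ℝ 2 μ) X := fun p ↦
    Gamma.tensor (fun _ : Fin 1 ↦ p.1) fun _ ↦ p.2
  let B : Lp ℝ 2 μ × X → Gamma (Lp ℝ 2 μ) Y := fun p ↦
    ⟨pettisOp (hmem (fun _ : Fin 1 ↦ p.1) fun _ ↦ p.2),
      mem_gammaSubmodule_of_not_containsCZero hY (ne_top_of_le_ne_top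
        (ENNReal.mul_ne_top (by simp) (gammaNorm_tensorOp_ne_top _ _)) (hγ _ _))⟩
  have hA : ∀ {N : ℕ} (h : Fin N → Lp ℝ 2 μ) (x : Fin N → X),
      ∑ n, A (h n, x n) = Gamma.tensor h x := by
    intro N h x
    refine Gamma.toOp_injective ?_
    rw [map_sum]
    ext v
    simp [A, sum_apply]
  have hB : ∀ {N : ℕ} (h : Fin N → Lp ℝ 2 μ) (x : Fin N → X),
      Gamma.toOp _ _ (∑ n, B (h n, x n)) = pettisOp (hmem h x) := by
    intro N h x
    rw [map_sum]
    ext g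
    rw [sum_apply, pettisOp_apply]
    have h1 : ∀ n, Gamma.toOp _ _ (B (h n, x n)) g = ∫ s, g s • h n s • M s (x n) ∂μ := by
      intro n
      change pettisOp (hmem (fun _ : Fin 1 ↦ h n) fun _ ↦ x n) g = _
      rw [pettisOp_apply]
      simp
    simp only [h1, Finset.smul_sum]
    rw [integral_finsetSum]
    intro n _
    have := integrable_Lp_smul (hmem (fun _ : Fin 1 ↦ h n) fun _ ↦ x n) g
    simpa using this
  -- The operator is first defined on formal combinations of elementary
  -- tensors, and the norm bound makes it factor through their image and extend by continuity.
  let e := Finsupp.linearCombination ℝ A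
  let f := Finsupp.linearCombination ℝ B
  -- A formal combination is a tensor: absorb the coefficients into the vectors.
  have hbound : ∀ z, ‖f z‖ ≤ C * ‖e z‖ := by
    intro z
    let E := z.support.equivFin.symm
    let h : Fin z.support.card → Lp ℝ 2 μ := fun n ↦ z (E n) • (E n : Lp ℝ 2 μ × X).1
    let x : Fin z.support.card → X := fun n ↦ (E n : Lp ℝ 2 μ × X).2
    have hAs : ∀ (c : ℝ) p, c • A p = A (c • p.1, p.2) := by
      intro c p
      refine Gamma.toOp_injective ?_
      ext v
      simp [A, inner_smul_left, smul_smul]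
    have hBs : ∀ (c : ℝ) p, c • B p = B (c • p.1, p.2) := by
      intro c p
      refine Gamma.toOp_injective ?_
      ext g
      rw [map_smul, smul_apply]
      change c • pettisOp (hmem (fun _ : Fin 1 ↦ p.1) fun _ ↦ p.2) g =
        pettisOp (hmem (fun _ : Fin 1 ↦ c • p.1) fun _ ↦ p.2) g
      rw [pettisOp_apply, pettisOp_apply, ← integral_smul]
      refine integral_congr_ae ?_
      filter_upwards [Lp.coeFn_smul c p.1] with s hs
      simp [hs, smul_smul, mul_left_comm]
    have he : e z = Gamma.tensor h x := by
      rw [← hA]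
      simp only [h, x, ← hAs]
      rw [E.sum_comp fun p : z.support ↦ z p • A p, Finset.sum_coe_sort z.support fun p ↦ z p • A p]
      rfl
    have hf : f z = ∑ n, B (h n, x n) := by
      simp only [h, x, ← hBs]
      rw [E.sum_comp fun p : z.support ↦ z p • B p, Finset.sum_coe_sort z.support fun p ↦ z p • B p]
      rfl
    rw [he, Gamma.norm_def, Gamma.norm_def, hf, hB, Gamma.toOp_tensor]
    have := ENNReal.toReal_mono
      (ENNReal.mul_ne_top (by simp) (gammaNorm_tensorOp_ne_top h x)) (hγ h x)
    rwa [ENNReal.toReal_mul, ENNReal.coe_toReal] at this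
  have hdense : DenseRange e := by
    refine Gamma.dense_tensor.mono ?_
    rintro _ ⟨N, h, x, rfl⟩
    refine ⟨∑ n, Finsupp.single (h n, x n) 1, ?_⟩
    rw [← hA, map_sum]
    simp [e]
  refine ⟨f.extendOfNorm e, LinearMap.opNorm_extendOfNorm_le hdense C.2 hbound,
    fun N h x g ↦ ?_⟩
  have h1 : Gamma.tensor h x = e (∑ n, Finsupp.single (h n, x n) 1) := by
    rw [← hA, map_sum]
    simp [e]
  have h2 : f (∑ n, Finsupp.single (h n, x n) 1) = ∑ n, B (h n, x n) := by
    rw [map_sum]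
    simp [f]
  rw [h1, LinearMap.extendOfNorm_eq hdense ⟨C, hbound⟩, h2, hB, pettisOp_apply]

end MultiplierOperator

/-! ### Composition operators and integration over the triangle -/

section CompositionOperator

variable {S S' : Type*} [MeasurableSpace S] [MeasurableSpace S'] {μ : Measure S} {ν : Measure S'}
  {π : S → S'} {c : ℝ}

/-- Composition with a map `π` satisfying `π_* μ ≤ c ν` is bounded from `L²(ν)` to `L²(μ)`, with
norm at most `√c`. -/
theorem exists_Lp_comp (hπ : Measurable π) (hμν : μ.map π ≤ ENNReal.ofReal c • ν) :
    ∃ J : Lp ℝ 2 ν →L[ℝ] Lp ℝ 2 μ, ‖J‖ ≤ √c ∧ ∀ g, J g =ᵐ[μ] fun s ↦ g (π s) := by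
  have hle : ∀ g : Lp ℝ 2 ν, eLpNorm (g ∘ π) 2 μ ≤ ENNReal.ofReal (√c) * eLpNorm g 2 ν := by
    intro g
    rw [← eLpNorm_map_measure (((Lp.aestronglyMeasurable g).smul_measure _).mono_measure hμν)
      hπ.aemeasurable]
    refine (eLpNorm_mono_measure _ hμν).trans_eq ?_
    rw [eLpNorm_smul_measure_of_ne_top (by simp), smul_eq_mul, Real.sqrt_eq_rpow]
    rcases le_total 0 c with hc | hc
    · rw [ENNReal.ofReal_rpow_of_nonneg hc (by norm_num)]
      simp
    · rw [← Real.sqrt_eq_rpow, Real.sqrt_eq_zero'.2 hc, ENNReal.ofReal_eq_zero.2 hc]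
      simp
  have hac : Measure.QuasiMeasurePreserving π μ ν :=
    ⟨hπ, (Measure.absolutelyContinuous_of_le hμν).trans Measure.smul_absolutelyContinuous⟩
  have hmem : ∀ g : Lp ℝ 2 ν, MemLp (g ∘ π) 2 μ := fun g ↦
    ⟨(Lp.aestronglyMeasurable g).comp_quasiMeasurePreserving hac,
      (hle g).trans_lt (ENNReal.mul_lt_top (by simp) (Lp.memLp g).2)⟩
  let J : Lp ℝ 2 ν →ₗ[ℝ] Lp ℝ 2 μ :=
    { toFun := fun g ↦ (hmem g).toLp
      map_add' := fun f g ↦ by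
        rw [← MemLp.toLp_add]
        exact MemLp.toLp_congr _ _ (hac.ae_eq_comp (Lp.coeFn_add f g))
      map_smul' := fun a g ↦ by
        rw [RingHom.id_apply, ← MemLp.toLp_const_smul]
        exact MemLp.toLp_congr _ _ (hac.ae_eq_comp (Lp.coeFn_smul a g)) }
  refine ⟨J.mkContinuous (√c) fun g ↦ ?_, J.mkContinuous_norm_le (Real.sqrt_nonneg c) _,
    fun g ↦ (hmem g).coeFn_toLp⟩
  have h1 := ENNReal.toReal_mono (ENNReal.mul_ne_top (by simp) (Lp.memLp g).2.ne) (hle g)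
  rw [ENNReal.toReal_mul, ENNReal.toReal_ofReal (Real.sqrt_nonneg c)] at h1
  change ‖(hmem g).toLp‖ ≤ _
  rwa [Lp.norm_toLp, Lp.norm_def]

end CompositionOperator

section Triangle

variable {T : ℝ} {Y : Type*} [NormedAddCommGroup Y]

lemma measurableSet_triangle (T : ℝ) : MeasurableSet (triangle T) :=
  (measurableSet_lt measurable_const measurable_fst).inter
    ((measurableSet_le measurable_fst measurable_snd).inter
      (measurableSet_lt measurable_snd measurable_const))

lemma volTri_le_prod (T : ℝ) : volTri T ≤ (volI T).prod (volI T) := by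
  rw [volI, Measure.prod_restrict, ← Measure.volume_eq_prod]
  refine Measure.restrict_mono_set _ fun p hp ↦ ?_
  exact ⟨⟨hp.1, hp.2.1.trans_lt hp.2.2⟩, ⟨hp.1.trans_le hp.2.1, hp.2.2⟩⟩

lemma volI_univ (T : ℝ) : volI T univ = ENNReal.ofReal T := by simp [volI]

instance : IsFiniteMeasure (volI T) := ⟨by simp [volI_univ]⟩

instance : IsFiniteMeasure (volTri T) :=
  ⟨(volTri_le_prod T univ).trans_lt (measure_lt_top _ _)⟩

lemma map_fst_volTri_le (T : ℝ) : (volTri T).map Prod.fst ≤ ENNReal.ofReal T • volI T := by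
  refine (Measure.map_mono (volTri_le_prod T) measurable_fst).trans_eq ?_
  rw [Measure.map_fst_prod, volI_univ]

lemma map_snd_volTri_le (T : ℝ) : (volTri T).map Prod.snd ≤ ENNReal.ofReal T • volI T := by
  refine (Measure.map_mono (volTri_le_prod T) measurable_snd).trans_eq ?_
  rw [Measure.map_snd_prod, volI_univ]

/-- The section of `Δ` at height `t ∈ (0, T)` is the interval `(0, t]`. -/
lemma indicator_triangle_of_mem {E : Type*} [Zero E] (F : ℝ × ℝ → E) {t : ℝ} (ht : t ∈ Ioo 0 T) :
    (fun s ↦ (triangle T).indicator F (s, t)) = (Ioc 0 t).indicator fun s ↦ F (s, t) := by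
  ext s
  by_cases hs : s ∈ Ioc 0 t
  · rw [indicator_of_mem hs, indicator_of_mem]
    exact ⟨hs.1, hs.2, ht.2⟩
  · rw [indicator_of_notMem hs, indicator_of_notMem]
    exact fun h ↦ hs ⟨h.1, h.2.1⟩

lemma indicator_triangle_of_notMem {E : Type*} [Zero E] (F : ℝ × ℝ → E) {t : ℝ}
    (ht : t ∉ Ioo 0 T) (s : ℝ) : (triangle T).indicator F (s, t) = 0 :=
  indicator_of_notMem (fun h ↦ ht ⟨h.1.trans_le h.2.1, h.2.2⟩) _

lemma lintegral_volTri {G : ℝ × ℝ → ℝ≥0∞} (hG : AEMeasurable G (volTri T)) :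
    ∫⁻ p, G p ∂volTri T = ∫⁻ t, (∫⁻ s in Ioc 0 t, G (s, t)) ∂volI T := by
  have hG' : AEMeasurable ((triangle T).indicator G) (volume.prod volume) :=
    (aemeasurable_indicator_iff (measurableSet_triangle T)).2 hG
  rw [volTri, ← lintegral_indicator (measurableSet_triangle T), Measure.volume_eq_prod,
    lintegral_prod_symm _ hG', volI, ← lintegral_indicator measurableSet_Ioo]
  refine lintegral_congr fun t ↦ ?_
  by_cases ht : t ∈ Ioo 0 T
  · rw [indicator_of_mem ht, indicator_triangle_of_mem G ht, lintegral_indicator measurableSet_Ioc]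
  · simp [indicator_of_notMem ht, indicator_triangle_of_notMem G ht]

lemma ae_intervalIntegrable_of_integrable_volTri {F : ℝ × ℝ → Y} (hF : Integrable F (volTri T)) :
    ∀ᵐ t ∂volI T, IntervalIntegrable (fun s ↦ F (s, t)) volume 0 t := by
  have hF' : Integrable ((triangle T).indicator F) (volume.prod volume) :=
    (integrable_indicator_iff (measurableSet_triangle T)).2 hF
  filter_upwards [ae_restrict_of_ae hF'.prod_left_ae, ae_restrict_mem measurableSet_Ioo] with t h ht
  rw [indicator_triangle_of_mem F ht, integrable_indicator_iff measurableSet_Ioc] at h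
  rwa [intervalIntegrable_iff_integrableOn_Ioc_of_le ht.1.le]

variable [NormedSpace ℝ Y]

lemma integral_indicator_triangle (F : ℝ × ℝ → Y) {t : ℝ} (ht : t ∈ Ioo 0 T) :
    ∫ s, (triangle T).indicator F (s, t) = ∫ s in (0 : ℝ)..t, F (s, t) := by
  rw [indicator_triangle_of_mem F ht, integral_indicator measurableSet_Ioc,
    intervalIntegral.integral_of_le ht.1.le]

lemma integral_volTri {G : ℝ × ℝ → Y} (hG : Integrable G (volTri T)) :
    ∫ p, G p ∂volTri T = ∫ t, (∫ s in (0 : ℝ)..t, G (s, t)) ∂volI T := by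
  have hG' : Integrable ((triangle T).indicator G) (volume.prod volume) :=
    (integrable_indicator_iff (measurableSet_triangle T)).2 hG
  rw [volTri, ← integral_indicator (measurableSet_triangle T), Measure.volume_eq_prod,
    integral_prod_symm _ hG', volI, ← integral_indicator measurableSet_Ioo]
  refine integral_congr_ae (Filter.Eventually.of_forall fun t ↦ ?_)
  by_cases ht : t ∈ Ioo 0 T
  · simp only [indicator_of_mem ht, integral_indicator_triangle G ht]
  · simp [indicator_of_notMem ht, indicator_triangle_of_notMem G ht]

lemma aestronglyMeasurable_integral_triangle {F : ℝ × ℝ → Y}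
    (hF : AEStronglyMeasurable F (volTri T)) :
    AEStronglyMeasurable (fun t ↦ ∫ s in (0 : ℝ)..t, F (s, t)) (volI T) := by
  have hF' : AEStronglyMeasurable ((triangle T).indicator F) (volume.prod volume) :=
    (aestronglyMeasurable_indicator_iff (measurableSet_triangle T)).2 hF
  refine (hF'.prod_swap.integral_prod_right'.restrict (s := Ioo 0 T)).congr ?_
  filter_upwards [ae_restrict_mem measurableSet_Ioo] with t ht
  exact integral_indicator_triangle F ht

/-- By the Cauchy–Schwarz inequality in the first variable, partial integration over `(0, t)` maps
`L²(Δ; Y)` into `L²(0, T; Y)`. -/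
lemma memLp_integral_triangle {F : ℝ × ℝ → Y} (hF : MemLp F 2 (volTri T)) :
    MemLp (fun t ↦ ∫ s in (0 : ℝ)..t, F (s, t)) 2 (volI T) := by
  refine ⟨aestronglyMeasurable_integral_triangle hF.1, ?_⟩
  have hfin : ∫⁻ p, ‖F p‖ₑ ^ 2 ∂volTri T < ∞ := by
    have := lintegral_rpow_enorm_lt_top_of_eLpNorm_lt_top (by simp) (by simp) hF.2
    simpa using this
  rw [lintegral_volTri (hF.1.enorm.pow_const 2)] at hfin
  have hint := ae_intervalIntegrable_of_integrable_volTri (hF.integrable (by norm_num))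
  rw [eLpNorm_lt_top_iff_lintegral_rpow_enorm_lt_top (by simp) (by simp)]
  simp only [ENNReal.toReal_ofNat, ENNReal.rpow_ofNat]
  refine lt_of_le_of_lt (lintegral_mono_ae (g := fun t ↦
    ENNReal.ofReal T * ∫⁻ s in Ioc 0 t, ‖F (s, t)‖ₑ ^ 2) ?_) ?_
  · filter_upwards [hint, ae_restrict_mem measurableSet_Ioo] with t h ht
    rw [intervalIntegrable_iff_integrableOn_Ioc_of_le ht.1.le] at h
    have h1 := eLpNorm_le_eLpNorm_mul_rpow_measure_univ (p := 1) (q := 2) (by norm_num) h.1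
    have h2 : ‖∫ s in (0 : ℝ)..t, F (s, t)‖ₑ ≤
        eLpNorm (fun s ↦ F (s, t)) 1 (volume.restrict (Ioc 0 t)) := by
      rw [intervalIntegral.integral_of_le ht.1.le, eLpNorm_one_eq_lintegral_enorm]
      exact enorm_integral_le_lintegral_enorm _
    refine (pow_le_pow_left' (h2.trans h1) 2).trans ?_
    rw [mul_pow, mul_comm, eLpNorm_eq_lintegral_rpow_enorm_toReal (by simp) (by simp),
      ← ENNReal.rpow_natCast, ← ENNReal.rpow_natCast, ← ENNReal.rpow_mul, ← ENNReal.rpow_mul]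
    norm_num
    gcongr
    exact ht.2.le
  · rw [lintegral_const_mul' _ _ (by simp)]
    exact ENNReal.mul_lt_top (by simp) hfin

end Triangle

/-! ### The integral operators -/

section DefinedElements

variable {S : Type*} [MeasurableSpace S] {μ : Measure S} {H X Y : Type*}
  [NormedAddCommGroup H] [InnerProductSpace ℝ H] [NormedAddCommGroup X] [NormedSpace ℝ X]
  [NormedAddCommGroup Y] [NormedSpace ℝ Y]

lemma Defines.unique {f : S → X} {R R' : Gamma (Lp ℝ 2 μ) X} (h : Defines μ f R)
    (h' : Defines μ f R') : R = R' := by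
  refine Gamma.toOp_injective ?_
  ext g
  exact (SeparatingDual.eq_iff_forall_dual_eq (R := ℝ)).2 fun φ ↦
    (h.2.2 g φ).trans (h'.2.2 g φ).symm

lemma Gamma.ext_tensor {Φ Ψ : Gamma H X →L[ℝ] Gamma (Lp ℝ 2 μ) Y}
    (h : ∀ (N : ℕ) (h : Fin N → H) (x : Fin N → X),
      Ψ (Gamma.tensor h x) = Φ (Gamma.tensor h x)) : Ψ = Φ := by
  refine ContinuousLinearMap.coeFn_injective
    (Continuous.ext_on Gamma.dense_tensor Ψ.continuous Φ.continuous ?_)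
  rintro _ ⟨N, u, x, rfl⟩
  exact h N u x

lemma IsTensor.comp {S' : Type*} [MeasurableSpace S'] {ν : Measure S'} {π : S → S'}
    (hπ : Measure.QuasiMeasurePreserving π μ ν) {J : Lp ℝ 2 ν → Lp ℝ 2 μ}
    (hJ : ∀ g, J g =ᵐ[μ] fun s ↦ g (π s)) {N : ℕ} {h : Fin N → Lp ℝ 2 ν} {x : Fin N → X}
    {f : S' → X} (hf : IsTensor ν h x f) : IsTensor μ (fun n ↦ J (h n)) x (f ∘ π) := by
  filter_upwards [hπ.ae_eq_comp hf, ae_all_iff.2 fun n ↦ hJ (h n)] with s hs hn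
  simp only [hn]
  exact hs

end DefinedElements

section IntegralOperators

variable {X Y : Type*} [NormedAddCommGroup X] [NormedSpace ℝ X]
  [NormedAddCommGroup Y] [NormedSpace ℝ Y] {T : ℝ}
  {𝒯 : Set (X →L[ℝ] Y)} {C : ℝ≥0}

lemma quasiMeasurePreserving_snd_sub_fst :
    Measure.QuasiMeasurePreserving (fun p : ℝ × ℝ ↦ p.2 - p.1) volume volume := by
  have h1 := quasiMeasurePreserving_sub (volume : Measure ℝ) (volume : Measure ℝ)
  exact h1.comp Measure.measurePreserving_swap.quasiMeasurePreserving

lemma ae_sub_mem_Ioo_volTri (T : ℝ) : ∀ᵐ p ∂volTri T, p.2 - p.1 ∈ Ioo 0 T := by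
  have h1 : ∀ᵐ r : ℝ, r ≠ 0 := by simp [ae_iff]
  filter_upwards [ae_restrict_of_ae (quasiMeasurePreserving_snd_sub_fst.ae h1),
    ae_restrict_mem (measurableSet_triangle T)] with p h0 hp
  exact ⟨lt_of_le_of_ne (sub_nonneg.2 hp.2.1) h0.symm, by linarith [hp.1, hp.2.2]⟩

lemma aestronglyMeasurable_comp_snd_sub_fst {E : Type*} [NormedAddCommGroup E] {w : ℝ → E}
    (hw : AEStronglyMeasurable w (volI T)) :
    AEStronglyMeasurable (fun p : ℝ × ℝ ↦ w (p.2 - p.1)) (volTri T) := by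
  have h1 := ((aestronglyMeasurable_indicator_iff measurableSet_Ioo).2
    hw).comp_quasiMeasurePreserving quasiMeasurePreserving_snd_sub_fst
  refine (h1.restrict (s := triangle T)).congr ?_
  filter_upwards [ae_sub_mem_Ioo_volTri T] with p hp
  exact indicator_of_mem hp _

lemma aestronglyMeasurable_comp_sub_left {E : Type*} [NormedAddCommGroup E] {w : ℝ → E}
    (hw : AEStronglyMeasurable w (volI T)) {t : ℝ} (ht : t ∈ Ioo 0 T) :
    AEStronglyMeasurable (fun s ↦ w (t - s)) (volume.restrict (Ioo 0 t)) := by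
  have h1 := (Measure.measurePreserving_sub_left volume t).restrict_preimage
    (measurableSet_Ioo (a := 0) (b := T))
  refine (hw.comp_measurePreserving h1).mono_measure (Measure.restrict_mono_set _ fun s hs ↦ ?_)
  exact ⟨by linarith [hs.2], by linarith [hs.1, ht.2]⟩

lemma intervalIntegrable_convolution (h𝒯 : HasGammaBound 𝒯 C) {M : ℝ → X →L[ℝ] Y}
    (hM : ∀ x, AEStronglyMeasurable (fun t ↦ M t x) (volI T)) (hM𝒯 : ∀ t ∈ Ioo 0 T, M t ∈ 𝒯)
    {N : ℕ} {h : Fin N → Lp ℝ 2 (volI T)} {x : Fin N → X} {f : ℝ → X}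
    (hf : IsTensor (volI T) h x f) {t : ℝ} (ht : t ∈ Ioo 0 T) :
    IntervalIntegrable (fun s ↦ M (t - s) (f s)) volume 0 t := by
  rw [intervalIntegrable_iff_integrableOn_Ioo_of_le ht.1.le]
  have hle : volume.restrict (Ioo 0 t) ≤ volI T :=
    Measure.restrict_mono_set _ (Ioo_subset_Ioo_right ht.2.le)
  have h1 : ∀ n, IntegrableOn (fun s ↦ h n s • M (t - s) (x n)) (Ioo 0 t) volume := by
    intro n
    have h2 : Integrable (h n) (volume.restrict (Ioo 0 t)) :=
      ((Lp.memLp (h n)).integrable (by norm_num)).mono_measure hle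
    refine (h2.norm.mul_const (C * ‖x n‖)).mono'
      (h2.1.smul (aestronglyMeasurable_comp_sub_left (hM (x n)) ht)) ?_
    filter_upwards [ae_restrict_mem measurableSet_Ioo] with s hs
    rw [norm_smul]
    exact mul_le_mul_of_nonneg_left ((M (t - s)).le_of_opNorm_le (h𝒯.norm_le
      (hM𝒯 _ ⟨by linarith [hs.2], by linarith [hs.1, ht.2]⟩)) _) (norm_nonneg _)
  refine (integrable_finsetSum Finset.univ fun n _ ↦ h1 n).congr ?_
  filter_upwards [(Measure.absolutelyContinuous_of_le hle).ae_le hf] with s hs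
  simp [hs]

variable [CompleteSpace Y]

/-- If `Y` does not contain `c₀`, a strongly measurable kernel on `Δ` with values in a `γ`-bounded
family induces a bounded operator from `γ(Δ; X)` to `γ(0, T; Y)`: multiply by the kernel, then
restrict to the functions of `L²(Δ)` that depend on the second variable only. -/
theorem exists_triInt_operator (hY : ¬ ContainsCZero Y) (h𝒯 : HasGammaBound 𝒯 C)
    {M : ℝ × ℝ → X →L[ℝ] Y} (hM : ∀ x, AEStronglyMeasurable (fun p ↦ M p x) (volTri T))
    (hM𝒯 : ∀ᵐ p ∂volTri T, M p ∈ 𝒯) :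
    ∃ Φ : GammaTri T X →L[ℝ] GammaI T Y, ‖Φ‖ ≤ √T * C ∧
      ∀ (N : ℕ) (h : Fin N → Lp ℝ 2 (volTri T)) (x : Fin N → X) (f : ℝ × ℝ → X),
        IsTensor (volTri T) h x f →
        (∀ᵐ t ∂volI T, IntervalIntegrable (fun s ↦ M (s, t) (f (s, t))) volume 0 t) ∧
        Defines (volI T) (triInt M f) (Φ (Gamma.tensor h x)) := by
  obtain ⟨Θ, hΘ, hΘt⟩ := exists_multiplier hY h𝒯 hM hM𝒯
  obtain ⟨J, hJ, hJc⟩ := exists_Lp_comp measurable_snd (map_snd_volTri_le T)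
  refine ⟨(Gamma.compRight J).comp Θ, (ContinuousLinearMap.opNorm_comp_le _ _).trans
    (mul_le_mul ((Gamma.norm_compRight_le J).trans hJ) hΘ (norm_nonneg _) (Real.sqrt_nonneg _)),
    fun N h x f hf ↦ ?_⟩
  have hMf : (fun p ↦ ∑ n, h n p • M p (x n)) =ᵐ[volTri T] fun p ↦ M p (f p) := by
    filter_upwards [hf] with p hp
    simp [hp]
  have hF : MemLp (fun p ↦ M p (f p)) 2 (volTri T) :=
    (memLp_congr_ae hMf).1 (memLp_multiplier h𝒯 hM hM𝒯 h x)
  have hu : MemLp (triInt M f) 2 (volI T) := memLp_integral_triangle hF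
  refine ⟨ae_intervalIntegrable_of_integrable_volTri (hF.integrable (by norm_num)), hu.1,
    fun φ ↦ φ.comp_memLp' hu, fun g φ ↦ ?_⟩
  rw [ContinuousLinearMap.comp_apply, Gamma.toOp_compRight, ContinuousLinearMap.comp_apply, hΘt,
    φ.integral_comp_comm (integrable_Lp_smul hu g)]
  have hgF : (fun p ↦ J g p • ∑ n, h n p • M p (x n)) =ᵐ[volTri T]
      fun p ↦ g p.2 • M p (f p) := by
    filter_upwards [hJc g, hMf] with p h1 h2
    rw [h1, h2]
  rw [integral_congr_ae hgF,
    integral_volTri (((integrable_Lp_smul hF (J g)).congr ?_))]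
  · congr 2
    ext t
    exact intervalIntegral.integral_smul (g t) fun s ↦ M (s, t) (f (s, t))
  · filter_upwards [hJc g] with p h1
    rw [h1]

/-- If `Y` does not contain `c₀`, convolution with a strongly measurable function with values in a
`γ`-bounded family is bounded from `γ(0, T; X)` to `γ(0, T; Y)`: it is the operator with kernel
`M(t - s)` on `Δ`, applied to functions of the first variable only. -/
theorem exists_convInt_operator (hY : ¬ ContainsCZero Y) (h𝒯 : HasGammaBound 𝒯 C)
    {M : ℝ → X →L[ℝ] Y} (hM : ∀ x, AEStronglyMeasurable (fun t ↦ M t x) (volI T))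
    (hM𝒯 : ∀ t ∈ Ioo 0 T, M t ∈ 𝒯) (hT : 0 ≤ T) :
    ∃ Φ : GammaI T X →L[ℝ] GammaI T Y, ‖Φ‖ ≤ T * C ∧
      ∀ (N : ℕ) (h : Fin N → Lp ℝ 2 (volI T)) (x : Fin N → X) (f : ℝ → X),
        IsTensor (volI T) h x f →
        Defines (volI T) (convInt M f) (Φ (Gamma.tensor h x)) := by
  obtain ⟨Φ, hΦ, hΦt⟩ := exists_triInt_operator hY h𝒯 (M := fun p ↦ M (p.2 - p.1))
    (fun x ↦ aestronglyMeasurable_comp_snd_sub_fst (hM x))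
    ((ae_sub_mem_Ioo_volTri T).mono fun p hp ↦ hM𝒯 _ hp)
  obtain ⟨J, hJ, hJc⟩ := exists_Lp_comp measurable_fst (map_fst_volTri_le T)
  have hJ' : ‖Gamma.compRight (X := X) J.adjoint‖ ≤ √T := by
    refine (Gamma.norm_compRight_le _).trans ?_
    rwa [LinearIsometryEquiv.norm_map]
  refine ⟨Φ.comp (Gamma.compRight J.adjoint), ?_, fun N h x f hf ↦ ?_⟩
  · refine (ContinuousLinearMap.opNorm_comp_le _ _).trans ((mul_le_mul hΦ hJ' (norm_nonneg _)
      (by positivity)).trans_eq ?_)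
    rw [mul_right_comm, Real.mul_self_sqrt hT]
  · rw [ContinuousLinearMap.comp_apply, Gamma.compRight_tensor,
      ContinuousLinearMap.adjoint_adjoint]
    exact (hΦt N _ x _ (hf.comp ⟨measurable_fst, (Measure.absolutelyContinuous_of_le
      (map_fst_volTri_le T)).trans Measure.smul_absolutelyContinuous⟩ hJc)).2

end IntegralOperators

end GammaRad

theorem mainTheorem6 {X Y : Type*}
    [NormedAddCommGroup X] [NormedSpace ℝ X] [CompleteSpace X]
    [NormedAddCommGroup Y] [NormedSpace ℝ Y] [CompleteSpace Y]
    (hY : ¬ GammaRad.ContainsCZero Y) (T : ℝ) (hT : 0 < T) :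
    (∀ M : ℝ → X →L[ℝ] Y,
      (∀ x : X, AEStronglyMeasurable (fun t ↦ M t x) (GammaRad.volI T)) →
      GammaRad.IsGammaBounded (M '' Ioo 0 T) →
      (∀ (N : ℕ) (h : Fin N → Lp ℝ 2 (GammaRad.volI T)) (x : Fin N → X) (f : ℝ → X),
        GammaRad.IsTensor (GammaRad.volI T) h x f →
        (∀ t ∈ Ioo 0 T, IntervalIntegrable (fun s ↦ M (t - s) (f s)) volume 0 t) ∧
        ∃ R : GammaRad.GammaI T Y,
          GammaRad.Defines (GammaRad.volI T) (GammaRad.convInt M f) R ∧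
          ‖R‖ ≤ T * GammaRad.gammaBound (M '' Ioo 0 T) * ‖GammaRad.Gamma.tensor h x‖) ∧
      (∃ Φ : GammaRad.GammaI T X →L[ℝ] GammaRad.GammaI T Y,
        (∀ (N : ℕ) (h : Fin N → Lp ℝ 2 (GammaRad.volI T)) (x : Fin N → X) (f : ℝ → X),
          GammaRad.IsTensor (GammaRad.volI T) h x f →
          GammaRad.Defines (GammaRad.volI T) (GammaRad.convInt M f)
            (Φ (GammaRad.Gamma.tensor h x))) ∧
        ‖Φ‖ ≤ T * GammaRad.gammaBound (M '' Ioo 0 T) ∧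
        ∀ Ψ : GammaRad.GammaI T X →L[ℝ] GammaRad.GammaI T Y,
          (∀ (N : ℕ) (h : Fin N → Lp ℝ 2 (GammaRad.volI T)) (x : Fin N → X) (f : ℝ → X),
            GammaRad.IsTensor (GammaRad.volI T) h x f →
            GammaRad.Defines (GammaRad.volI T) (GammaRad.convInt M f)
              (Ψ (GammaRad.Gamma.tensor h x))) →
          Ψ = Φ)) ∧
    (∀ M : ℝ × ℝ → X →L[ℝ] Y,
      (∀ x : X, AEStronglyMeasurable (fun p ↦ M p x) (GammaRad.volTri T)) →
      GammaRad.IsGammaBounded (M '' GammaRad.triangle T) →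
      (∀ (N : ℕ) (h : Fin N → Lp ℝ 2 (GammaRad.volTri T)) (x : Fin N → X) (f : ℝ × ℝ → X),
        GammaRad.IsTensor (GammaRad.volTri T) h x f →
        (∀ᵐ t ∂(GammaRad.volI T),
          IntervalIntegrable (fun s ↦ M (s, t) (f (s, t))) volume 0 t) ∧
        ∃ R : GammaRad.GammaI T Y,
          GammaRad.Defines (GammaRad.volI T) (GammaRad.triInt M f) R ∧
          ‖R‖ ≤ √T * GammaRad.gammaBound (M '' GammaRad.triangle T) *
            ‖GammaRad.Gamma.tensor h x‖) ∧
      (∃ Φ : GammaRad.GammaTri T X →L[ℝ] GammaRad.GammaI T Y,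
        (∀ (N : ℕ) (h : Fin N → Lp ℝ 2 (GammaRad.volTri T)) (x : Fin N → X) (f : ℝ × ℝ → X),
          GammaRad.IsTensor (GammaRad.volTri T) h x f →
          GammaRad.Defines (GammaRad.volI T) (GammaRad.triInt M f)
            (Φ (GammaRad.Gamma.tensor h x))) ∧
        ‖Φ‖ ≤ √T * GammaRad.gammaBound (M '' GammaRad.triangle T) ∧
        ∀ Ψ : GammaRad.GammaTri T X →L[ℝ] GammaRad.GammaI T Y,
          (∀ (N : ℕ) (h : Fin N → Lp ℝ 2 (GammaRad.volTri T)) (x : Fin N → X) (f : ℝ × ℝ → X),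
            GammaRad.IsTensor (GammaRad.volTri T) h x f →
            GammaRad.Defines (GammaRad.volI T) (GammaRad.triInt M f)
              (Ψ (GammaRad.Gamma.tensor h x))) →
          Ψ = Φ)) := by
  refine ⟨fun M hM hγ ↦ ?_, fun M hM hγ ↦ ?_⟩
  · have h𝒯 := GammaRad.hasGammaBound_gammaBound hγ
    have hM𝒯 : ∀ t ∈ Ioo 0 T, M t ∈ M '' Ioo 0 T := fun t ht ↦ mem_image_of_mem M ht
    obtain ⟨Φ, hΦ, hΦt⟩ := GammaRad.exists_convInt_operator hY h𝒯 hM hM𝒯 hT.le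
    refine ⟨fun N h x f hf ↦ ⟨fun t ht ↦ GammaRad.intervalIntegrable_convolution h𝒯 hM hM𝒯 hf ht,
      Φ (GammaRad.Gamma.tensor h x), hΦt N h x f hf, Φ.le_of_opNorm_le hΦ _⟩,
      Φ, hΦt, hΦ, fun Ψ hΨ ↦ GammaRad.Gamma.ext_tensor fun N h x ↦ ?_⟩
    have hf : GammaRad.IsTensor (GammaRad.volI T) h x fun s ↦ ∑ n, h n s • x n :=
      Filter.EventuallyEq.rfl
    exact (hΨ N h x _ hf).unique (hΦt N h x _ hf)
  · have h𝒯 := GammaRad.hasGammaBound_gammaBound hγ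
    obtain ⟨Φ, hΦ, hΦt⟩ := GammaRad.exists_triInt_operator hY h𝒯 hM
      ((ae_restrict_mem (GammaRad.measurableSet_triangle T)).mono fun p hp ↦ mem_image_of_mem M hp)
    refine ⟨fun N h x f hf ↦ ⟨(hΦt N h x f hf).1, Φ (GammaRad.Gamma.tensor h x),
      (hΦt N h x f hf).2, Φ.le_of_opNorm_le hΦ _⟩,
      Φ, fun N h x f hf ↦ (hΦt N h x f hf).2, hΦ,
      fun Ψ hΨ ↦ GammaRad.Gamma.ext_tensor fun N h x ↦ ?_⟩
    have hf : GammaRad.IsTensor (GammaRad.volTri T) h x fun s ↦ ∑ n, h n s • x n :=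
      Filter.EventuallyEq.rfl
    exact (hΨ N h x _ hf).unique (hΦt N h x _ hf).2
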